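/- Let $\mathbb{G}$ be a compact Lie group with normalized Haar measure, and let $\mathcal{L}$ be its Laplace–Beltrami operator with respect to a bi-invariant Riemannian metric, i.e. the Casimir operator $\mathcal{L}=\sum_j X_j^2$, where $(X_j)$ is an orthonormal basis, with respect to an $\mathrm{Ad}(\mathbb{G})$-invariant inner product on the Lie algebra, of left-invariant vector fields. Let $(-\mathcal{L})^{1/2}$ be defined on $L^2(\mathbb{G})$ by the spectral resolution of $-\mathcal{L}$, and let $$H^1_{\mathcal{L}}(\mathbb{G})=\{f\in L^2(\mathbb{G}) : (-\mathcal{L})^{1/2}f\in L^2(\mathbb{G})\},\qquad \|f\|_{H^1_{\mathcal{L}}(\mathbb{G})}=\|f\|_{L^2(\mathbb{G})}+\|(-\mathcal{L})^{1/2}f\|_{L^2(\mathbb{G})}.$$ Then there is a constant $C>0$ such that the following holds. Let $(u_0,u_1)\in H^1_{\mathcal{L}}(\mathbb{G})\times L^2(\mathbb{G})$ and let $u\in \mathcal{C}([0,\infty),H^1_{\mathcal{L}}(\mathbb{G}))\cap \mathcal{C}^1([0,\infty),L^2(\mathbb{G}))$ be the solution of the homogeneous Cauchy problem $$\partial_t^2u-\mathcal{L}u+\partial_tu=0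 \quad (x\in\mathbb{G},\ t>0),\qquad u(0,\cdot)=u_0,\qquad \partial_tu(0,\cdot)=u_1,$$ where the equation is understood weakly: for every $\varphi\in\mathcal{C}^\infty(\mathbb{G})$ the function $t\mapsto\int_{\mathbb{G}}\partial_tu(t,x)\varphi(x)\,\mathrm{d}x$ is differentiable on $(0,\infty)$ with derivative $\int_{\mathbb{G}}u(t,x)\,\mathcal{L}\varphi(x)\,\mathrm{d}x-\int_{\mathbb{G}}\partial_tu(t,x)\varphi(x)\,\mathrm{d}x$. Then, for all $t\ge 0$, $$\|u(t,\cdot)\|_{L^2(\mathbb{G})}\le C\left(\|u_0\|_{L^2(\mathbb{G})}+\|u_1\|_{L^2(\mathbb{G})}\right),$$ $$\|(-\mathcal{L})^{1/2}u(t,\cdot)\|_{L^2(\mathbb{G})}\le C(1+t)^{-1/2}\left(\|u_0\|_{H^1_{\mathcal{L}}(\mathbb{G})}+\|u_1\|_{L^2(\mathbb{G})}\right),$$ $$\|\partial_tu(t,\cdot)\|_{L^2(\mathbb{G})}\le C(1+t)^{-1}\left(\|u_0\|_{H^1_{\mathcal{L}}(\mathbb{G})}+\|u_1\|_{L^2(\mathbb{G})}\right).$$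 -/

import Mathlib

open Set Filter Topology MeasureTheory
open scoped Manifold ContDiff ENNReal NNReal

namespace DampedWave

section LaplaceBeltrami

variable {E : Type*} [NormedAddCommGroup E] [NormedSpace ℝ E]
  {H : Type*} [TopologicalSpace H] (I : ModelWithCorners ℝ E H)
  (G : Type*) [TopologicalSpace G] [ChartedSpace H G] [Group G]

variable {G} in
/-- The adjoint action `Ad g : 𝔤 → 𝔤`, the differential at the identity of the conjugation
`x ↦ g x g⁻¹`, which fixes the identity. -/
noncomputable def adjointAction (g : G) (v : GroupLieAlgebra I G) : GroupLieAlgebra I G :=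
  (mfderiv I I (fun x : G => g * x * g⁻¹) (1 : G) v : TangentSpace I (g * 1 * g⁻¹))

/-- A bi-invariant Riemannian metric on the Lie group `G`, given by its value at the identity:
an inner product on the Lie algebra (extended to `G` by left translations) that is invariant
under the adjoint action (so that the extension is also invariant under right translations). -/
structure BiInvariantMetric where
  /-- the inner product on the Lie algebra -/
  form : LinearMap.BilinForm ℝ (GroupLieAlgebra I G)
  symm : ∀ v w, form v w = form w v
  posDef : ∀ v, v ≠ 0 → 0 < form v v
  adInvariant : ∀ (g : G) (v w : GroupLieAlgebra I G),
    form (adjointAction I g v) (adjointAction I g w) = form v w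

variable {I G}

theorem BiInvariantMetric.nondegenerate (m : BiInvariantMetric I G) : m.form.Nondegenerate := by
  constructor
  · intro v hv
    by_contra h
    exact (m.posDef v h).ne' (hv v)
  · intro v hv
    by_contra h
    exact (m.posDef v h).ne' (hv v)

/-- The derivative `X_v f` of a function along the left-invariant vector field `X_v`. -/
noncomputable def lieDeriv (v : GroupLieAlgebra I G) (f : G → ℂ) (x : G) : ℂ :=
  (mfderiv I 𝓘(ℝ, ℂ) f x (mulInvariantVectorField v x) : TangentSpace 𝓘(ℝ, ℂ) (f x))

theorem finiteDimensional_lieAlgebra [FiniteDimensional ℝ E] :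
    FiniteDimensional ℝ (GroupLieAlgebra I G) :=
  inferInstanceAs (FiniteDimensional ℝ E)

/-- The Laplace-Beltrami operator of a bi-invariant metric, on smooth functions: the Casimir
element `∑ᵢ Xᵢ Xⁱ`, where `(Xᵢ)` is a basis of the Lie algebra and `(Xⁱ)` is its dual basis with
respect to the metric, acting by left-invariant vector fields. It does not depend on the basis;
for an orthonormal basis it is the sum of squares `∑ᵢ Xᵢ²`. -/
noncomputable def laplaceBeltrami [FiniteDimensional ℝ E] (m : BiInvariantMetric I G)
    (f : G → ℂ) (x : G) : ℂ :=
  haveI : FiniteDimensional ℝ (GroupLieAlgebra I G) := finiteDimensional_lieAlgebra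
  let b := Module.finBasis ℝ (GroupLieAlgebra I G)
  ∑ i, lieDeriv (b i) (lieDeriv (m.form.dualBasis m.nondegenerate b i) f) x

end LaplaceBeltrami

section Sobolev

variable {E : Type*} [NormedAddCommGroup E] [NormedSpace ℝ E] [FiniteDimensional ℝ E]
  {H : Type*} [TopologicalSpace H] {I : ModelWithCorners ℝ E H}
  {G : Type*} [TopologicalSpace G] [ChartedSpace H G] [Group G] [MeasurableSpace G]
  (m : BiInvariantMetric I G) (μ : Measure G)

/-- The eigenspace in `L²(G)` of `-L` for the eigenvalue `a`, consisting of the classes of the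
smooth solutions of `-L φ = a φ`. (It is finite-dimensional on a compact group, so that passing
to the closure changes nothing; the closure only provides the orthogonal projection.) -/
noncomputable def eigenspace (a : ℝ≥0) : Submodule ℂ (Lp ℂ 2 μ) :=
  (Submodule.span ℂ {f : Lp ℂ 2 μ | ∃ φ : G → ℂ, ContMDiff I 𝓘(ℝ, ℂ) ∞ φ ∧
    (∀ x, -laplaceBeltrami m φ x = ((a : ℝ) : ℂ) * φ x) ∧ f =ᵐ[μ] φ}).topologicalClosure

instance (a : ℝ≥0) : CompleteSpace (eigenspace m μ a) :=
  (Submodule.isClosed_topologicalClosure _).completeSpace_coe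

/-- The orthogonal projection of `f` onto the eigenspace of `-L` for the eigenvalue `a`. -/
noncomputable def eigenComponent (a : ℝ≥0) (f : Lp ℂ 2 μ) : Lp ℂ 2 μ :=
  (eigenspace m μ a).starProjection f

/-- The operator `(-L)^{s/2}`, `s > 0`, given by the spectral resolution of `-L`:
`(-L)^{s/2} f = ∑ₐ a^{s/2} Pₐ f`, where `Pₐ` is the projection onto the eigenspace for `a`.
The series is meaningful for `f` in the domain `MemSobolev m μ s f`. -/
noncomputable def fracLaplacian (s : ℝ) (f : Lp ℂ 2 μ) : Lp ℂ 2 μ :=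
  ∑' a : ℝ≥0, (((a : ℝ) ^ (s / 2) : ℝ) : ℂ) • eigenComponent m μ a f

/-- `f ∈ H^s_L(G)`: the function `f ∈ L²(G)` lies in the domain of `(-L)^{s/2}`, that is,
`∑ₐ a^s ‖Pₐ f‖² < ∞`. -/
def MemSobolev (s : ℝ) (f : Lp ℂ 2 μ) : Prop :=
  Summable fun a : ℝ≥0 => (a : ℝ) ^ s * ‖eigenComponent m μ a f‖ ^ 2

/-- The norm `‖f‖ + ‖(-L)^{s/2} f‖` of `H^s_L(G)`. -/
noncomputable def sobolevNorm (s : ℝ) (f : Lp ℂ 2 μ) : ℝ :=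
  ‖f‖ + ‖fracLaplacian m μ s f‖

/-- `u` belongs to `C([0,∞), H¹_L(G)) ∩ C¹([0,∞), L²(G))`, has the time derivative `ut`, and
solves `∂ₜ² u - L u + ∂ₜ u = 0` in the weak sense, with the data `u(0) = u₀`, `∂ₜ u(0) = u₁`. -/
structure IsSolution (u₀ u₁ : Lp ℂ 2 μ) (u ut : ℝ → Lp ℂ 2 μ) : Prop where
  memSobolev : ∀ t, 0 ≤ t → MemSobolev m μ 1 (u t)
  continuous_sobolev : ∀ t, 0 ≤ t →
    Tendsto (fun s => sobolevNorm m μ 1 (u s - u t)) (𝓝[Ici 0] t) (𝓝 0)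
  hasDerivWithinAt : ∀ t, 0 ≤ t → HasDerivWithinAt u (ut t) (Ici 0) t
  continuousOn_deriv : ContinuousOn ut (Ici 0)
  weak_equation : ∀ φ : G → ℂ, ContMDiff I 𝓘(ℝ, ℂ) ∞ φ → ∀ t, 0 < t →
    HasDerivAt (fun s => ∫ x, ut s x * φ x ∂μ)
      ((∫ x, u t x * laplaceBeltrami m φ x ∂μ) - ∫ x, ut t x * φ x ∂μ) t
  initial_value : u 0 = u₀
  initial_deriv : ut 0 = u₁

end Sobolev

end DampedWave

/-!
# Decay for the damped wave equation on a compact Lie group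

Expand a solution along the eigenspaces of `-L`. If `φ` is smooth with `-L φ = a φ`, then, by the
weak equation tested against the conjugate of `φ`, the coefficient `c t = ⟪φ, u t⟫` solves the
scalar equation `c'' + c' + a c = 0` (`IsSolution.inner_decay`). The energy
`(c' + c)² + c'² + 2 a c²` decays at a rate proportional to `min a 1`. For small `a` a factor `a`
is worth a factor `(1 + t)⁻¹` against this decay, and `c'` is of order `a c` up to an exponentially
small term; so the estimates hold with a constant that does not depend on `a ≥ 0`
(`dampedOscillator_decay`). By this uniformity neither the discreteness of the spectrum nor a
spectral gap is needed: the estimates pass to the components of the solution in the eigenspaces, and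
are then summed over all `a` by Parseval's identity (`IsSolution.norm_sq_decay`).

Parseval's identity requires that the eigenspaces of `-L` be orthogonal and span a dense subspace
of `L²`. The operator `L` is a sum of squares of left-invariant vector fields, each of which is
skew-symmetric since Haar measure is invariant under right translations; hence `L` is symmetric and
nonpositive. For density (`iSup_eigenspace_orthogonal`), convolution with a smooth symmetric
kernel is a compact self-adjoint operator on `L²` whose image consists of smooth functions and
which commutes with `L`. Each of its eigenspaces for a nonzero eigenvalue is finite-dimensional,
consists of smooth functions and is preserved by the symmetric operator `L`, so it is spanned by
eigenfunctions of `L` (`convOp_eigenspace_le`). Hence a function orthogonal to all the eigenspaces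
of `L` is annihilated by all these convolutions, and vanishes since they contain an approximate
identity.
-/

namespace DampedWave

/-! ### Uniform decay for the scalar equation `c'' + c' + a c = 0` -/

theorem le_exp_mul_of_deriv_le {f f' : ℝ → ℝ} {k : ℝ} (hc : ContinuousOn f (Ici 0))
    (hd : ∀ t, 0 < t → HasDerivAt f (f' t) t) (hle : ∀ t, 0 < t → f' t ≤ -k * f t)
    {t : ℝ} (ht : 0 ≤ t) : f t ≤ Real.exp (-k * t) * f 0 := by
  have hderiv : ∀ t, 0 < t → HasDerivAt (fun s => Real.exp (k * s) * f s)
      (Real.exp (k * t) * k * f t + Real.exp (k * t) * f' t) t := fun t ht => by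
    have h1 : HasDerivAt (fun s : ℝ => Real.exp (k * s)) (Real.exp (k * t) * k) t := by
      simpa using ((hasDerivAt_id t).const_mul k).exp
    exact h1.mul (hd t ht)
  have hanti : AntitoneOn (fun s => Real.exp (k * s) * f s) (Ici 0) := by
    refine antitoneOn_of_deriv_nonpos (convex_Ici 0) (by fun_prop) ?_ ?_
    · intro s hs
      rw [interior_Ici] at hs
      exact (hderiv s hs).differentiableAt.differentiableWithinAt
    · intro s hs
      rw [interior_Ici] at hs
      rw [(hderiv s hs).deriv]
      nlinarith [hle s hs, Real.exp_pos (k * s)]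
  have h := hanti (mem_Ici.2 le_rfl) (mem_Ici.2 ht) ht
  simp only [mul_zero, Real.exp_zero, one_mul] at h
  calc f t = Real.exp (-k * t) * (Real.exp (k * t) * f t) := by
        rw [← mul_assoc, ← Real.exp_add]; simp
    _ ≤ _ := mul_le_mul_of_nonneg_left h (Real.exp_pos _).le

theorem mul_exp_neg_le_one (x : ℝ) : x * Real.exp (-x) ≤ 1 := by
  rw [Real.exp_neg, ← div_eq_mul_inv, div_le_one (Real.exp_pos x)]
  linarith [Real.add_one_le_exp x]

theorem one_add_mul_exp_neg_le {b k t : ℝ} (hk : 0 < k) (hb : 0 ≤ b) (hb1 : b ≤ 1) (ht : 0 ≤ t) :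
    (1 + t) * b * Real.exp (-(b / k) * t) ≤ 1 + k := by
  have h1 := mul_exp_neg_le_one (b / k * t)
  have h2 : Real.exp (-(b / k) * t) ≤ 1 := Real.exp_le_one_iff.2 (by
    have : 0 ≤ b / k * t := by positivity
    linarith)
  have h3 : t * b * Real.exp (-(b / k) * t) = k * (b / k * t * Real.exp (-(b / k * t))) := by
    rw [neg_mul]; field_simp
  have h4 : b * Real.exp (-(b / k) * t) ≤ 1 * 1 := by gcongr
  nlinarith

theorem one_add_mul_exp_neg_sq_le {b k t : ℝ} (hk : 0 < k) (hb : 0 ≤ b) (hb1 : b ≤ 1)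
    (ht : 0 ≤ t) :
    (1 + t) ^ 2 * b ^ 2 * Real.exp (-(b / k) * t) ≤ (1 + 2 * k) ^ 2 := by
  have h := one_add_mul_exp_neg_le (k := 2 * k) (by positivity) hb hb1 ht
  have : Real.exp (-(b / k) * t) = Real.exp (-(b / (2 * k)) * t) ^ 2 := by
    rw [← Real.exp_nat_mul]; congr 1; push_cast; field_simp
  rw [this, ← mul_pow, ← mul_pow]
  gcongr

/-- Decay of the solutions of `c'' + c' + a c = 0`, with a constant that does not depend on
`a ≥ 0`. The energy `(c' + c)² + c'² + 2 a c²` has derivative `-2 (c'² + a c²)` and hence decays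
like `exp (-min a 1 * t / 2)`; for small `a` the bound on `c'` needs one more comparison, since
there `c'` is of order `a c`. The constant is `409 = 4 * 5² * 4 + 3²`, from that comparison. -/
theorem dampedOscillator_decay_real {a : ℝ} (ha : 0 ≤ a) {c p : ℝ → ℝ}
    (hc : ContinuousOn c (Ici 0)) (hp : ContinuousOn p (Ici 0))
    (hc' : ∀ t, 0 < t → HasDerivAt c (p t) t)
    (hp' : ∀ t, 0 < t → HasDerivAt p (-(a * c t) - p t) t) {t : ℝ} (ht : 0 ≤ t) :
    c t ^ 2 ≤ 409 * (c 0 ^ 2 + p 0 ^ 2) ∧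
    (1 + t) * (a * c t ^ 2) ≤ 409 * ((1 + a) * c 0 ^ 2 + p 0 ^ 2) ∧
    (1 + t) ^ 2 * p t ^ 2 ≤ 409 * ((1 + a) * c 0 ^ 2 + p 0 ^ 2) := by
  set M : ℝ → ℝ := fun t => (p t + c t) ^ 2 + p t ^ 2 + 2 * a * c t ^ 2 with hM
  have hMc : ContinuousOn M (Ici 0) := by fun_prop
  have hMd : ∀ t, 0 < t → HasDerivAt M (-2 * (a * c t ^ 2 + p t ^ 2)) t := fun t ht => by
    have h := ((((hp' t ht).add (hc' t ht)).pow 2).add ((hp' t ht).pow 2)).add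
      (((hc' t ht).pow 2).const_mul (2 * a))
    refine h.congr_deriv ?_
    rw [Pi.add_apply]
    push_cast
    ring
  have hM0 : ∀ t, 0 ≤ M t := fun t => by positivity
  have hMle : ∀ t, M t ≤ 3 * p t ^ 2 + 2 * c t ^ 2 + 2 * a * c t ^ 2 := fun t => by
    simp only [hM]; nlinarith [sq_nonneg (p t - c t)]
  rcases le_total a 1 with h1 | h1
  · have hdecay : ∀ s, 0 ≤ s → M s ≤ Real.exp (-(a / 2) * s) * M 0 := fun s hs => by
      refine le_exp_mul_of_deriv_le hMc hMd (fun r _ => ?_) hs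
      have h2 : a / 2 * M r ≤ a / 2 * (3 * p r ^ 2 + 2 * c r ^ 2 + 2 * a * c r ^ 2) := by
        gcongr; exact hMle r
      nlinarith [mul_nonneg (sub_nonneg.2 h1) (sq_nonneg (p r)),
        mul_nonneg (mul_nonneg ha (sub_nonneg.2 h1)) (sq_nonneg (c r)), sq_nonneg (p r)]
    have hcM : ∀ s, c s ^ 2 ≤ 2 * M s := fun s => by
      simp only [hM]
      nlinarith [sq_nonneg (2 * p s + c s), mul_nonneg ha (sq_nonneg (c s))]
    have hM00 : M 0 ≤ 4 * (c 0 ^ 2 + p 0 ^ 2) := by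
      nlinarith [hMle 0, mul_nonneg (sub_nonneg.2 h1) (sq_nonneg (c 0)), sq_nonneg (p 0)]
    have hac : 0 ≤ a * c 0 ^ 2 := by positivity
    refine ⟨?_, ?_, ?_⟩
    · have h2 : Real.exp (-(a / 2) * t) ≤ 1 := Real.exp_le_one_iff.2 (by nlinarith)
      have h3 := mul_le_mul_of_nonneg_right h2 (hM0 0)
      nlinarith [hcM t, hdecay t ht, sq_nonneg (c 0), sq_nonneg (p 0)]
    · have h2 := one_add_mul_exp_neg_le (k := 2) two_pos ha h1 ht
      calc (1 + t) * (a * c t ^ 2)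
          ≤ (1 + t) * (a * (2 * (Real.exp (-(a / 2) * t) * M 0))) := by
            gcongr; linarith [hcM t, hdecay t ht]
        _ = 2 * ((1 + t) * a * Real.exp (-(a / 2) * t)) * M 0 := by ring
        _ ≤ 2 * (1 + 2) * M 0 := by gcongr
        _ ≤ _ := by nlinarith [sq_nonneg (c 0), sq_nonneg (p 0)]
    · -- Comparison with the supersolution `4 a² M(0) exp (-a t / 2)` of the inequality
      -- `(p²)' ≤ -p² + a² c²`.
      have hexp : ∀ s, HasDerivAt (fun s => Real.exp (-(a / 2) * s))
          (Real.exp (-(a / 2) * s) * (-(a / 2))) s := fun s => by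
        simpa using ((hasDerivAt_id s).const_mul (-(a / 2))).exp
      have hR := le_exp_mul_of_deriv_le (k := 1)
        (f := fun s => p s ^ 2 - 4 * a ^ 2 * M 0 * Real.exp (-(a / 2) * s))
        (f' := fun s => 2 * p s * (-(a * c s) - p s) -
          4 * a ^ 2 * M 0 * (Real.exp (-(a / 2) * s) * (-(a / 2)))) (by fun_prop)
        (fun s hs => by
          have h := ((hp' s hs).pow 2).sub ((hexp s).const_mul (4 * a ^ 2 * M 0))
          refine h.congr_deriv ?_
          push_cast; ring)
        (fun s hs => by
          have h2 : c s ^ 2 ≤ 2 * (Real.exp (-(a / 2) * s) * M 0) := by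
            linarith [hcM s, hdecay s hs.le]
          have h3 : a ^ 2 * c s ^ 2 ≤ a ^ 2 * (2 * (Real.exp (-(a / 2) * s) * M 0)) := by gcongr
          have h4 : 0 ≤ (1 - a) * (a ^ 2 * (Real.exp (-(a / 2) * s) * M 0)) :=
            mul_nonneg (by linarith) (mul_nonneg (sq_nonneg a)
              (mul_nonneg (Real.exp_pos _).le (hM0 0)))
          nlinarith [sq_nonneg (p s + a * c s)]) ht
      have hp2 : p t ^ 2 ≤ 4 * a ^ 2 * M 0 * Real.exp (-(a / 2) * t) +
          Real.exp (-(1 / 1) * t) * p 0 ^ 2 := by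
        have h2 : 0 ≤ Real.exp (-1 * t) * (4 * a ^ 2 * M 0) := by
          have := hM0 0
          positivity
        simp only [mul_zero, Real.exp_zero, mul_one, div_one] at hR ⊢
        nlinarith
      have h2 := one_add_mul_exp_neg_sq_le (k := 2) two_pos ha h1 ht
      have h3 := one_add_mul_exp_neg_sq_le (k := 1) (b := 1) one_pos zero_le_one le_rfl ht
      calc (1 + t) ^ 2 * p t ^ 2 ≤ (1 + t) ^ 2 * (4 * a ^ 2 * M 0 * Real.exp (-(a / 2) * t) +
            Real.exp (-(1 / 1) * t) * p 0 ^ 2) := by gcongr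
        _ = 4 * ((1 + t) ^ 2 * a ^ 2 * Real.exp (-(a / 2) * t)) * M 0 +
            ((1 + t) ^ 2 * 1 ^ 2 * Real.exp (-(1 / 1) * t)) * p 0 ^ 2 := by ring
        _ ≤ 4 * (1 + 2 * 2) ^ 2 * M 0 + (1 + 2 * 1) ^ 2 * p 0 ^ 2 := by
            gcongr
        _ ≤ _ := by nlinarith [sq_nonneg (c 0), sq_nonneg (p 0)]
  · have hdecay : M t ≤ Real.exp (-(1 / 2) * t) * M 0 := by
      refine le_exp_mul_of_deriv_le hMc hMd (fun r _ => ?_) ht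
      nlinarith [hMle r, mul_nonneg (sub_nonneg.2 h1) (sq_nonneg (c r)), sq_nonneg (p r)]
    have hM00 : M 0 ≤ 4 * (a * c 0 ^ 2 + p 0 ^ 2) := by
      nlinarith [hMle 0, mul_nonneg (sub_nonneg.2 h1) (sq_nonneg (c 0)), sq_nonneg (p 0)]
    refine ⟨?_, ?_, ?_⟩
    · have h2 : Real.exp (-(1 / 2) * t) ≤ 1 := Real.exp_le_one_iff.2 (by linarith)
      have h3 := mul_le_mul_of_nonneg_right h2 (hM0 0)
      have h4 : 2 * a * c t ^ 2 ≤ M t := by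
        simp only [hM]
        nlinarith [sq_nonneg (p t + c t), sq_nonneg (p t)]
      have h5 : p 0 ^ 2 ≤ a * p 0 ^ 2 := le_mul_of_one_le_left (sq_nonneg _) h1
      have h6 : a * c t ^ 2 ≤ a * (2 * (c 0 ^ 2 + p 0 ^ 2)) := by nlinarith
      have h7 := le_of_mul_le_mul_left h6 (by linarith)
      nlinarith [sq_nonneg (c 0), sq_nonneg (p 0)]
    · have h2 := one_add_mul_exp_neg_le (k := 2) (b := 1) two_pos zero_le_one le_rfl ht
      have h4 : a * c t ^ 2 ≤ M t := by
        simp only [hM]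
        nlinarith [sq_nonneg (p t + c t), sq_nonneg (p t), mul_nonneg ha (sq_nonneg (c t))]
      calc (1 + t) * (a * c t ^ 2) ≤ (1 + t) * (Real.exp (-(1 / 2) * t) * M 0) :=
            mul_le_mul_of_nonneg_left (by linarith) (by positivity)
        _ = ((1 + t) * 1 * Real.exp (-(1 / 2) * t)) * M 0 := by ring
        _ ≤ (1 + 2) * M 0 := by gcongr
        _ ≤ _ := by nlinarith [sq_nonneg (c 0), sq_nonneg (p 0), mul_nonneg ha (sq_nonneg (c 0))]
    · have h2 := one_add_mul_exp_neg_sq_le (k := 2) (b := 1) two_pos zero_le_one le_rfl ht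
      have h4 : p t ^ 2 ≤ M t := by
        simp only [hM]
        nlinarith [sq_nonneg (p t + c t), sq_nonneg (p t), mul_nonneg ha (sq_nonneg (c t))]
      calc (1 + t) ^ 2 * p t ^ 2 ≤ (1 + t) ^ 2 * (Real.exp (-(1 / 2) * t) * M 0) :=
            mul_le_mul_of_nonneg_left (by linarith) (by positivity)
        _ = ((1 + t) ^ 2 * 1 ^ 2 * Real.exp (-(1 / 2) * t)) * M 0 := by ring
        _ ≤ (1 + 2 * 2) ^ 2 * M 0 := by gcongr
        _ ≤ _ := by nlinarith [sq_nonneg (c 0), sq_nonneg (p 0), mul_nonneg ha (sq_nonneg (c 0))]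

theorem dampedOscillator_decay {a : ℝ} (ha : 0 ≤ a) {c p : ℝ → ℂ}
    (hc : ContinuousOn c (Ici 0)) (hp : ContinuousOn p (Ici 0))
    (hc' : ∀ t, 0 < t → HasDerivAt c (p t) t)
    (hp' : ∀ t, 0 < t → HasDerivAt p (-((a : ℂ) * c t) - p t) t) {t : ℝ} (ht : 0 ≤ t) :
    ‖c t‖ ^ 2 ≤ 409 * (‖c 0‖ ^ 2 + ‖p 0‖ ^ 2) ∧
    (1 + t) * (a * ‖c t‖ ^ 2) ≤ 409 * ((1 + a) * ‖c 0‖ ^ 2 + ‖p 0‖ ^ 2) ∧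
    (1 + t) ^ 2 * ‖p t‖ ^ 2 ≤ 409 * ((1 + a) * ‖c 0‖ ^ 2 + ‖p 0‖ ^ 2) := by
  have hre := dampedOscillator_decay_real ha (Complex.continuous_re.comp_continuousOn hc)
    (Complex.continuous_re.comp_continuousOn hp)
    (fun s hs => Complex.reCLM.hasFDerivAt.comp_hasDerivAt s (hc' s hs))
    (fun s hs => (Complex.reCLM.hasFDerivAt.comp_hasDerivAt s (hp' s hs)).congr_deriv
      (by simp)) ht
  have him := dampedOscillator_decay_real ha (Complex.continuous_im.comp_continuousOn hc)
    (Complex.continuous_im.comp_continuousOn hp)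
    (fun s hs => Complex.imCLM.hasFDerivAt.comp_hasDerivAt s (hc' s hs))
    (fun s hs => (Complex.imCLM.hasFDerivAt.comp_hasDerivAt s (hp' s hs)).congr_deriv
      (by simp)) ht
  simp only [Complex.sq_norm, Complex.normSq_apply, Function.comp_apply] at hre him ⊢
  obtain ⟨r1, r2, r3⟩ := hre
  obtain ⟨i1, i2, i3⟩ := him
  refine ⟨by nlinarith, by nlinarith, by nlinarith⟩

/-! ### Smooth parametric integrals over a compact manifold -/

section ParametricIntegral

variable {E : Type*} [NormedAddCommGroup E] [NormedSpace ℝ E]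
  {V : Type*} [NormedAddCommGroup V] [NormedSpace ℝ V]
  {H : Type*} [TopologicalSpace H] {I : ModelWithCorners ℝ E H}
  {G : Type*} [TopologicalSpace G] [ChartedSpace H G]

theorem contDiff_left_of_contMDiff {F : V → G → ℂ}
    (hF : ContMDiff (𝓘(ℝ, V).prod I) 𝓘(ℝ, ℂ) ∞ (Function.uncurry F)) (y : G) :
    ContDiff ℝ ∞ fun e => F e y := by
  rw [← contMDiff_iff_contDiff]
  exact hF.comp (contMDiff_id.prodMk contMDiff_const)

/-- The partial derivatives of a smooth function on `V × G` in the direction of the vector space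
`V` are jointly smooth. -/
theorem contMDiff_fderiv_left [IsManifold I ∞ G] {F : V → G → ℂ}
    (hF : ContMDiff (𝓘(ℝ, V).prod I) 𝓘(ℝ, ℂ) ∞ (Function.uncurry F)) :
    ContMDiff (𝓘(ℝ, V).prod I) 𝓘(ℝ, V →L[ℝ] ℂ) ∞
      fun q : V × G => fderiv ℝ (fun e => F e q.2) q.1 := by
  intro q
  have h1 : ContMDiffAt ((𝓘(ℝ, V).prod I).prod 𝓘(ℝ, V)) 𝓘(ℝ, ℂ) ∞
      (Function.uncurry fun (q : V × G) (e : V) => F e q.2) (q, q.1) :=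
    (hF.comp (contMDiff_snd.prodMk (contMDiff_snd.comp contMDiff_fst))).contMDiffAt
  have h2 := h1.mfderiv (fun (q : V × G) (e : V) => F e q.2) (fun q : V × G => q.1)
    contMDiff_fst.contMDiffAt (m := ∞) (by simp)
  simp only [mfderiv_eq_fderiv] at h2
  have h3 := inTangentCoordinates_model_space (I := 𝓘(ℝ, V)) (I' := 𝓘(ℝ, ℂ))
    (fun q : V × G => q.1) (fun q => F q.1 q.2) (fun q => fderiv ℝ (fun e => F e q.2) q.1) q
  rw [← h3]
  exact h2

theorem contMDiff_fderiv_left_apply [IsManifold I ∞ G] {F : V → G → ℂ}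
    (hF : ContMDiff (𝓘(ℝ, V).prod I) 𝓘(ℝ, ℂ) ∞ (Function.uncurry F)) (v : V) :
    ContMDiff (𝓘(ℝ, V).prod I) 𝓘(ℝ, ℂ) ∞
      (Function.uncurry fun e y => fderiv ℝ (fun e => F e y) e v) :=
  (contMDiff_fderiv_left hF).clm_apply contMDiff_const

variable [CompactSpace G] [MeasurableSpace G] [BorelSpace G] {μ : Measure G}

theorem exists_eventually_norm_le {K : Type*} [TopologicalSpace K] [CompactSpace K]
    {X W : Type*} [TopologicalSpace X] [NormedAddCommGroup W]
    {f : X × K → W} (hf : Continuous f) (x₀ : X) :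
    ∃ C, ∀ᶠ x in 𝓝 x₀, ∀ y, ‖f (x, y)‖ ≤ C := by
  obtain ⟨C, hC⟩ := (isCompact_univ (X := K)).exists_bound_of_continuousOn
    (f := fun y => f (x₀, y)) (by fun_prop)
  refine ⟨C + 1, ?_⟩
  have := isCompact_univ.eventually_forall_of_forall_eventually (x₀ := x₀)
    (P := fun x y => ‖f (x, y)‖ < C + 1) (K := (univ : Set K)) (fun y _ => by
      have h1 : ‖f (x₀, y)‖ < C + 1 := by linarith [hC y (mem_univ y)]
      have := (hf.norm.tendsto (x₀, y)).eventually (gt_mem_nhds h1)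
      exact this)
  filter_upwards [this] with x hx y using (hx y (mem_univ y)).le

theorem hasFDerivAt_integral_mul [IsManifold I ∞ G] [SecondCountableTopology G] {F : V → G → ℂ}
    (hF : ContMDiff (𝓘(ℝ, V).prod I) 𝓘(ℝ, ℂ) ∞ (Function.uncurry F)) {w : G → ℂ}
    (hw : Integrable w μ) (e₀ : V) :
    HasFDerivAt (fun e => ∫ y, w y * F e y ∂μ)
      (∫ y, w y • fderiv ℝ (fun e => F e y) e₀ ∂μ) e₀ := by
  have hF0 : ∀ e, Continuous (F e) := fun e =>
    hF.continuous.comp (Continuous.prodMk_right e)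
  have hF1 := (contMDiff_fderiv_left hF).continuous
  obtain ⟨C, hC⟩ := exists_eventually_norm_le hF1 e₀
  refine hasFDerivAt_integral_of_dominated_of_fderiv_le (𝕜 := ℝ)
    (F' := fun e y => w y • fderiv ℝ (fun e => F e y) e)
    (bound := fun y => ‖w y‖ * C) hC ?_ ?_ ?_ ?_ ?_ ?_
  · exact .of_forall fun e => hw.aestronglyMeasurable.mul (hF0 e).aestronglyMeasurable
  · obtain ⟨D, hD⟩ := isCompact_univ.exists_bound_of_continuousOn (hF0 e₀).continuousOn
    exact hw.mul_bdd (c := D) (hF0 e₀).aestronglyMeasurable (.of_forall fun y => hD y (mem_univ y))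
  · exact hw.aestronglyMeasurable.smul
      (hF1.comp (Continuous.prodMk_right e₀)).aestronglyMeasurable
  · refine .of_forall fun y e he => ?_
    rw [norm_smul]
    gcongr
    exact he y
  · exact hw.norm.mul_const C
  · refine .of_forall fun y e _ => ?_
    have := ((contDiff_left_of_contMDiff hF y).differentiable (by simp) e).hasFDerivAt
    exact this.const_smul (w y)

theorem integrable_mul_fderiv [IsManifold I ∞ G] [SecondCountableTopology G] {F : V → G → ℂ}
    (hF : ContMDiff (𝓘(ℝ, V).prod I) 𝓘(ℝ, ℂ) ∞ (Function.uncurry F)) {w : G → ℂ}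
    (hw : Integrable w μ) (e₀ : V) :
    Integrable (fun y => w y • fderiv ℝ (fun e => F e y) e₀) μ := by
  have hF1 := (contMDiff_fderiv_left hF).continuous.comp (Continuous.prodMk_right e₀)
  obtain ⟨C, hC⟩ := isCompact_univ.exists_bound_of_continuousOn hF1.continuousOn
  exact hw.smul_bdd C hF1.aestronglyMeasurable (.of_forall fun y => hC y (mem_univ y))

theorem fderiv_integral_mul_apply [IsManifold I ∞ G] [SecondCountableTopology G] {F : V → G → ℂ}
    (hF : ContMDiff (𝓘(ℝ, V).prod I) 𝓘(ℝ, ℂ) ∞ (Function.uncurry F)) {w : G → ℂ}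
    (hw : Integrable w μ) (e₀ v : V) :
    fderiv ℝ (fun e => ∫ y, w y * F e y ∂μ) e₀ v =
      ∫ y, w y * fderiv ℝ (fun e => F e y) e₀ v ∂μ := by
  rw [(hasFDerivAt_integral_mul hF hw e₀).fderiv,
    ContinuousLinearMap.integral_apply (integrable_mul_fderiv hF hw e₀)]
  simp

/-- Integrals of smooth functions on `V × G` over the compact manifold `G`, with an integrable
weight, depend smoothly on the parameter in `V`. -/
theorem contDiff_integral_mul [FiniteDimensional ℝ V] [IsManifold I ∞ G]
    [SecondCountableTopology G] {F : V → G → ℂ}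
    (hF : ContMDiff (𝓘(ℝ, V).prod I) 𝓘(ℝ, ℂ) ∞ (Function.uncurry F)) {w : G → ℂ}
    (hw : Integrable w μ) :
    ContDiff ℝ ∞ fun e => ∫ y, w y * F e y ∂μ := by
  rw [contDiff_infty]
  intro n
  induction n generalizing F with
  | zero =>
    exact contDiff_zero.2 (continuous_iff_continuousAt.2 fun e =>
      (hasFDerivAt_integral_mul hF hw e).continuousAt)
  | succ n ih =>
    push_cast
    rw [contDiff_succ_iff_fderiv_apply]
    refine ⟨fun e => (hasFDerivAt_integral_mul hF hw e).differentiableAt, by simp, fun v => ?_⟩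
    simp_rw [fderiv_integral_mul_apply hF hw]
    exact ih (contMDiff_fderiv_left_apply hF v)

end ParametricIntegral

/-! ### Derivatives along left-invariant vector fields -/

section Charts

variable {E : Type*} [NormedAddCommGroup E] [NormedSpace ℝ E] [FiniteDimensional ℝ E]
  {H : Type*} [TopologicalSpace H] {I : ModelWithCorners ℝ E H} [I.Boundaryless]
  {G : Type*} [TopologicalSpace G] [ChartedSpace H G] [IsManifold I ∞ G]

variable (I) in
/-- Precomposing an inverse chart with a smooth map of the model space into a small ball that is
the identity near the centre gives a parametrization that is smooth on the whole model space. -/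
theorem exists_contMDiff_parametrization (x₀ : G) :
    ∃ Γ : E → G, ContMDiff 𝓘(ℝ, E) I ∞ Γ ∧ Γ (extChartAt I x₀ x₀) = x₀ ∧
      ∀ᶠ x in 𝓝 x₀, Γ (extChartAt I x₀ x) = x := by
  set c := extChartAt I x₀ x₀ with hc
  obtain ⟨r, hr, hball⟩ := Metric.mem_nhds_iff.1 (extChartAt_target_mem_nhds (I := I) x₀)
  let f : ContDiffBump (0 : E) := ⟨r / 4, r / 2, by positivity, by linarith⟩
  let R : E → E := fun e => c + f (e - c) • (e - c)
  have hRs : ContDiff ℝ ∞ R :=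
    contDiff_const.add ((f.contDiff.comp (contDiff_id.sub contDiff_const)).smul
      (contDiff_id.sub contDiff_const))
  have hRmem : ∀ e, R e ∈ (extChartAt I x₀).target := fun e => by
    refine hball ?_
    rw [Metric.mem_ball, dist_eq_norm, add_sub_cancel_left, norm_smul, Real.norm_eq_abs,
      abs_of_nonneg f.nonneg]
    by_cases h : ‖e - c‖ < r / 2
    · calc f (e - c) * ‖e - c‖ ≤ 1 * ‖e - c‖ := by gcongr; exact f.le_one
        _ < r := by linarith
    · rw [f.zero_of_le_dist (by simpa using h)]
      simpa using hr
  have hRid : ∀ᶠ e in 𝓝 c, R e = e := by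
    filter_upwards [Metric.ball_mem_nhds c (show 0 < r / 4 by positivity)] with e he
    have : f (e - c) = 1 := f.one_of_mem_closedBall (by
      rw [mem_closedBall_zero_iff, ← dist_eq_norm]
      exact (Metric.mem_ball.1 he).le)
    simp [R, this]
  refine ⟨fun e => (extChartAt I x₀).symm (R e), ?_, ?_, ?_⟩
  · exact (contMDiffOn_extChartAt_symm x₀).comp_contMDiff hRs.contMDiff hRmem
  · simp only [hRid.self_of_nhds]
    exact extChartAt_to_inv x₀
  · have h1 := (continuousAt_extChartAt (I := I) x₀).eventually hRid
    filter_upwards [h1, extChartAt_source_mem_nhds (I := I) x₀] with x hx hx'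
    rw [hx, (extChartAt I x₀).left_inv hx']

/-- Every tangent vector is the velocity of a smooth curve defined on the whole line. -/
theorem exists_contMDiff_curve (x₀ : G) (v : TangentSpace I x₀) :
    ∃ (γ : ℝ → G) (A : ℝ →L[ℝ] E), ContMDiff 𝓘(ℝ, ℝ) I ∞ γ ∧ γ 0 = x₀ ∧ A 1 = v ∧
      HasMFDerivAt 𝓘(ℝ, ℝ) I γ 0 A := by
  obtain ⟨Γ, hΓ, hΓc, hΓid⟩ := exists_contMDiff_parametrization I x₀
  have hφ : HasMFDerivAt I 𝓘(ℝ, E) (extChartAt I x₀) x₀ (mfderiv I 𝓘(ℝ, E) (extChartAt I x₀) x₀) :=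
    ((contMDiffAt_extChartAt (n := ∞)).mdifferentiableAt (by simp)).hasMFDerivAt
  have hΓd : HasMFDerivAt 𝓘(ℝ, E) I Γ (extChartAt I x₀ x₀)
      (mfderiv 𝓘(ℝ, E) I Γ (extChartAt I x₀ x₀)) :=
    (hΓ.mdifferentiable (by simp) _).hasMFDerivAt
  set A : E →L[ℝ] E := mfderiv I 𝓘(ℝ, E) (extChartAt I x₀) x₀
  set B : E →L[ℝ] E := mfderiv 𝓘(ℝ, E) I Γ (extChartAt I x₀ x₀)
  have hBA : B.comp A = ContinuousLinearMap.id ℝ E := by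
    have h1 : HasMFDerivAt I I (Γ ∘ extChartAt I x₀) x₀ (B.comp A) := hΓd.comp x₀ hφ
    have h2 : HasMFDerivAt I I (Γ ∘ extChartAt I x₀) x₀ (ContinuousLinearMap.id ℝ E) :=
      (hasMFDerivAt_id x₀).congr_of_eventuallyEq hΓid
    exact hasMFDerivAt_unique h1 h2
  let ℓ : ℝ → E := fun t => extChartAt I x₀ x₀ + t • A v
  have hℓs : ContDiff ℝ ∞ ℓ := by fun_prop
  have hℓ0 : ℓ 0 = extChartAt I x₀ x₀ := by simp [ℓ]
  have hℓ : HasMFDerivAt 𝓘(ℝ, ℝ) 𝓘(ℝ, E) ℓ 0 ((ContinuousLinearMap.id ℝ ℝ).smulRight (A v)) := by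
    refine HasFDerivAt.hasMFDerivAt ?_
    exact ((hasFDerivAt_id (𝕜 := ℝ) (0 : ℝ)).smul_const (A v)).const_add _
  refine ⟨Γ ∘ ℓ, B.comp ((ContinuousLinearMap.id ℝ ℝ).smulRight (A v)), hΓ.comp hℓs.contMDiff,
    by rw [Function.comp_apply, hℓ0, hΓc], ?_, ?_⟩
  · have h : B (A v) = v := congrArg (fun T : E →L[ℝ] E => T v) hBA
    simpa using h
  · rw [← hℓ0] at hΓd
    exact hΓd.comp (0 : ℝ) hℓ

end Charts

section Basic

variable {E : Type*} [NormedAddCommGroup E] [NormedSpace ℝ E]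
  {H : Type*} [TopologicalSpace H] {I : ModelWithCorners ℝ E H}
  {G : Type*} [TopologicalSpace G] [ChartedSpace H G]

theorem integrable_of_continuous {K : Type*} [TopologicalSpace K] [CompactSpace K]
    [MeasurableSpace K] [BorelSpace K] {μ : Measure K} [IsFiniteMeasure μ] {f : K → ℂ}
    (hf : Continuous f) : Integrable f μ :=
  hf.integrable_of_hasCompactSupport (HasCompactSupport.of_compactSpace f)

theorem contMDiff_conj {f : G → ℂ} (hf : ContMDiff I 𝓘(ℝ, ℂ) ∞ f) :
    ContMDiff I 𝓘(ℝ, ℂ) ∞ fun x => (starRingEnd ℂ) (f x) :=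
  (Complex.conjCLE.contDiff (n := ∞)).contMDiff.comp hf

theorem contMDiff_mul_complex {f g : G → ℂ} (hf : ContMDiff I 𝓘(ℝ, ℂ) ∞ f)
    (hg : ContMDiff I 𝓘(ℝ, ℂ) ∞ g) : ContMDiff I 𝓘(ℝ, ℂ) ∞ fun x => f x * g x :=
  (contDiff_mul (𝕜 := ℝ) (𝔸 := ℂ) (n := ∞)).contMDiff.comp (hf.prodMk_space hg)

variable [Group G]

theorem lieDeriv_add_left (v w : GroupLieAlgebra I G) (f : G → ℂ) (x : G) :
    lieDeriv (v + w) f x = lieDeriv v f x + lieDeriv w f x := by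
  simp only [lieDeriv, mulInvariantVectorField_add]
  exact map_add (mfderiv I 𝓘(ℝ, ℂ) f x) _ _

theorem lieDeriv_smul_left (c : ℝ) (v : GroupLieAlgebra I G) (f : G → ℂ) (x : G) :
    lieDeriv (c • v) f x = c * lieDeriv v f x := by
  simp only [lieDeriv, mulInvariantVectorField_smul]
  exact (map_smul (mfderiv I 𝓘(ℝ, ℂ) f x) _ _).trans (Complex.real_smul)

variable [LieGroup I ∞ G]

theorem contMDiff_mul_curve {γ : ℝ → G} (hγ : ContMDiff 𝓘(ℝ, ℝ) I ∞ γ) {f : G → ℂ}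
    (hf : ContMDiff I 𝓘(ℝ, ℂ) ∞ f) :
    ContMDiff (𝓘(ℝ, ℝ).prod I) 𝓘(ℝ, ℂ) ∞ (Function.uncurry fun t x => f (x * γ t)) :=
  hf.comp (contMDiff_snd.mul (hγ.comp contMDiff_fst))

/-- The derivative of `f` along the left-invariant field of `v` is the derivative of `f` under
right translation along a curve through the identity with velocity `v`. -/
theorem hasDerivAt_lieDeriv {v : GroupLieAlgebra I G} {γ : ℝ → G} {A : ℝ →L[ℝ] E}
    (hγ0 : γ 0 = 1) (hA : A 1 = v) (hγ : HasMFDerivAt 𝓘(ℝ, ℝ) I γ 0 A)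
    {f : G → ℂ} {x : G} (hf : MDifferentiableAt I 𝓘(ℝ, ℂ) f x) :
    HasDerivAt (fun t => f (x * γ t)) (lieDeriv v f x) 0 := by
  let P : E →L[ℝ] ℂ := mfderiv I 𝓘(ℝ, ℂ) f x
  let Q : E →L[ℝ] E := mfderiv I I (fun y => x * y) (1 : G)
  have hf' : ∀ z, z = x → HasMFDerivAt I 𝓘(ℝ, ℂ) f z P := by
    rintro _ rfl
    exact hf.hasMFDerivAt
  have hL' : ∀ z, z = (1 : G) → HasMFDerivAt I I (fun y => x * y) z Q := by
    rintro _ rfl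
    exact ((contMDiff_mul_left (n := ∞)).mdifferentiable (by simp) _).hasMFDerivAt
  have h := ((hf' (x * γ 0) (by rw [hγ0, mul_one])).comp (γ 0) (hL' _ hγ0)).comp (0 : ℝ) hγ
  have h2 : HasFDerivAt (fun t => f (x * γ t)) ((P.comp Q).comp A) 0 := h.hasFDerivAt
  refine h2.hasDerivAt.congr_deriv ?_
  rw [ContinuousLinearMap.comp_apply, hA]
  rfl

/-- Differentiating a weighted integral of right translates of a smooth function. -/
theorem hasDerivAt_integral_mul_curve [CompactSpace G] [SecondCountableTopology G]
    [MeasurableSpace G] [BorelSpace G] {μ : Measure G} {v : GroupLieAlgebra I G} {γ : ℝ → G}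
    (hγ : ContMDiff 𝓘(ℝ, ℝ) I ∞ γ)
    (hγv : ∀ (f : G → ℂ) (x : G), MDifferentiableAt I 𝓘(ℝ, ℂ) f x →
        HasDerivAt (fun t => f (x * γ t)) (lieDeriv v f x) 0)
    {f : G → ℂ} (hf : ContMDiff I 𝓘(ℝ, ℂ) ∞ f) {w : G → ℂ} (hw : Integrable w μ) :
    HasDerivAt (fun t => ∫ y, w y * f (y * γ t) ∂μ) (∫ y, w y * lieDeriv v f y ∂μ) 0 := by
  have hF := contMDiff_mul_curve hγ hf
  have h1 := (hasFDerivAt_integral_mul hF hw (0 : ℝ)).differentiableAt.hasDerivAt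
  refine h1.congr_deriv ?_
  refine (fderiv_integral_mul_apply hF hw 0 1).trans ?_
  congr 1 with y
  congr 1
  exact (hγv f y (hf.mdifferentiable (by simp) y)).deriv

end Basic

section LieDeriv

variable {E : Type*} [NormedAddCommGroup E] [NormedSpace ℝ E] [FiniteDimensional ℝ E]
  {H : Type*} [TopologicalSpace H] {I : ModelWithCorners ℝ E H} [I.Boundaryless]
  {G : Type*} [TopologicalSpace G] [ChartedSpace H G] [Group G] [LieGroup I ∞ G]

/-- A curve that realizes the derivative along the left-invariant field of `v` of every
differentiable function, by right translation. -/
theorem exists_curve_lieDeriv (v : GroupLieAlgebra I G) :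
    ∃ γ : ℝ → G, ContMDiff 𝓘(ℝ, ℝ) I ∞ γ ∧ γ 0 = 1 ∧
      ∀ (f : G → ℂ) (x : G), MDifferentiableAt I 𝓘(ℝ, ℂ) f x →
        HasDerivAt (fun t => f (x * γ t)) (lieDeriv v f x) 0 := by
  obtain ⟨γ, A, h1, h2, h3, h4⟩ := exists_contMDiff_curve (I := I) (1 : G) v
  exact ⟨γ, h1, h2, fun f x hf => hasDerivAt_lieDeriv h2 h3 h4 hf⟩

theorem contMDiff_lieDeriv (v : GroupLieAlgebra I G) {f : G → ℂ} (hf : ContMDiff I 𝓘(ℝ, ℂ) ∞ f) :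
    ContMDiff I 𝓘(ℝ, ℂ) ∞ (lieDeriv v f) := by
  obtain ⟨γ, h1, h2, h3⟩ := exists_curve_lieDeriv v
  have h4 := (contMDiff_fderiv_left_apply (contMDiff_mul_curve h1 hf) 1).comp
    ((contMDiff_const (c := (0 : ℝ))).prodMk (contMDiff_id (I := I) (M := G)))
  convert h4 using 1
  ext x
  exact (h3 f x (hf.mdifferentiable (by simp) x)).deriv.symm

theorem lieDeriv_mul (v : GroupLieAlgebra I G) {f g : G → ℂ} (hf : ContMDiff I 𝓘(ℝ, ℂ) ∞ f)
    (hg : ContMDiff I 𝓘(ℝ, ℂ) ∞ g) (x : G) :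
    lieDeriv v (fun y => f y * g y) x = lieDeriv v f x * g x + f x * lieDeriv v g x := by
  obtain ⟨γ, h1, h2, h3⟩ := exists_curve_lieDeriv v
  have h4 := (h3 f x (hf.mdifferentiable (by simp) x)).mul
    (h3 g x (hg.mdifferentiable (by simp) x))
  simp only [h2, mul_one] at h4
  exact (h3 _ x ((contMDiff_mul_complex hf hg).mdifferentiable (by simp) x)).unique h4

theorem lieDeriv_add (v : GroupLieAlgebra I G) {f g : G → ℂ} (hf : ContMDiff I 𝓘(ℝ, ℂ) ∞ f)
    (hg : ContMDiff I 𝓘(ℝ, ℂ) ∞ g) :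
    lieDeriv v (fun y => f y + g y) = fun x => lieDeriv v f x + lieDeriv v g x := by
  obtain ⟨γ, h1, h2, h3⟩ := exists_curve_lieDeriv v
  ext x
  exact (h3 _ x ((hf.add hg).mdifferentiable (by simp) x)).unique
    ((h3 f x (hf.mdifferentiable (by simp) x)).add (h3 g x (hg.mdifferentiable (by simp) x)))

theorem lieDeriv_const_mul (v : GroupLieAlgebra I G) (c : ℂ) {f : G → ℂ}
    (hf : ContMDiff I 𝓘(ℝ, ℂ) ∞ f) :
    lieDeriv v (fun y => c * f y) = fun x => c * lieDeriv v f x := by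
  obtain ⟨γ, h1, h2, h3⟩ := exists_curve_lieDeriv v
  ext x
  exact (h3 _ x ((contMDiff_mul_complex contMDiff_const hf).mdifferentiable (by simp) x)).unique
    ((h3 f x (hf.mdifferentiable (by simp) x)).const_mul c)

theorem lieDeriv_conj (v : GroupLieAlgebra I G) {f : G → ℂ} (hf : ContMDiff I 𝓘(ℝ, ℂ) ∞ f) :
    lieDeriv v (fun y => (starRingEnd ℂ) (f y)) = fun x => (starRingEnd ℂ) (lieDeriv v f x) := by
  obtain ⟨γ, h1, h2, h3⟩ := exists_curve_lieDeriv v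
  ext x
  exact (h3 _ x ((contMDiff_conj hf).mdifferentiable (by simp) x)).unique
    (Complex.conjCLE.hasFDerivAt.comp_hasDerivAt 0 (h3 f x (hf.mdifferentiable (by simp) x)))

variable [CompactSpace G] [MeasurableSpace G] [BorelSpace G] {μ : Measure G}
  [SecondCountableTopology G]

/-- The integral of a right translate of `f` does not depend on the translation. -/
theorem integral_lieDeriv [IsFiniteMeasure μ] [μ.IsMulRightInvariant] (v : GroupLieAlgebra I G)
    {f : G → ℂ} (hf : ContMDiff I 𝓘(ℝ, ℂ) ∞ f) : ∫ y, lieDeriv v f y ∂μ = 0 := by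
  obtain ⟨γ, h1, h2, h3⟩ := exists_curve_lieDeriv v
  have h4 := hasDerivAt_integral_mul_curve (μ := μ) h1 h3 hf (integrable_const 1)
  have : IsTopologicalGroup G := topologicalGroup_of_lieGroup I ∞
  simp only [one_mul, integral_mul_right_eq_self f] at h4
  exact h4.unique (hasDerivAt_const _ _)

/-- Integration by parts on a compact group. -/
theorem integral_lieDeriv_mul [IsFiniteMeasure μ] [μ.IsMulRightInvariant]
    (v : GroupLieAlgebra I G) {f g : G → ℂ} (hf : ContMDiff I 𝓘(ℝ, ℂ) ∞ f)
    (hg : ContMDiff I 𝓘(ℝ, ℂ) ∞ g) :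
    ∫ x, lieDeriv v f x * g x ∂μ = -∫ x, f x * lieDeriv v g x ∂μ := by
  have h := integral_lieDeriv (μ := μ) v (contMDiff_mul_complex hf hg)
  rw [funext (lieDeriv_mul v hf hg), integral_add
    (integrable_of_continuous (contMDiff_mul_complex (contMDiff_lieDeriv v hf) hg).continuous)
    (integrable_of_continuous (contMDiff_mul_complex hf (contMDiff_lieDeriv v hg)).continuous)] at h
  exact eq_neg_of_add_eq_zero_left h

end LieDeriv

/-! ### The Laplace–Beltrami operator -/

/-- The canonical element `∑ᵢ bᵢ ⊗ bⁱ` of a positive definite form is `∑ₖ eₖ ⊗ eₖ` for an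
orthonormal basis `e`; here it is paired with an arbitrary bilinear map `D`. -/
theorem exists_sum_dualBasis_eq {V : Type*} [AddCommGroup V] [Module ℝ V] [FiniteDimensional ℝ V]
    (B : LinearMap.BilinForm ℝ V) (hB : B.Nondegenerate) (hsymm : ∀ v w, B v w = B w v)
    (hpos : ∀ v, v ≠ 0 → 0 < B v v) {ι : Type*} [Fintype ι] [DecidableEq ι]
    (b : Module.Basis ι ℝ V) :
    ∃ e : Fin (Module.finrank ℝ V) → V, ∀ D : V →ₗ[ℝ] V →ₗ[ℝ] ℂ,
      ∑ i, D (b i) (B.dualBasis hB b i) = ∑ k, D (e k) (e k) := by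
  have hBs : B.IsSymm := ⟨fun v w => hsymm v w⟩
  obtain ⟨v, hv⟩ :=
    LinearMap.BilinForm.exists_orthogonal_basis (LinearMap.BilinForm.isSymm_iff.1 hBs)
  have hd : ∀ k, 0 < B (v k) (v k) := fun k => hpos _ (v.ne_zero k)
  have hrepr : ∀ x k, v.repr x k = (B (v k) (v k))⁻¹ * B (v k) x := fun x k => by
    have h : B (v k) x = v.repr x k * B (v k) (v k) := by
      conv_lhs => rw [← v.sum_repr x]
      rw [map_sum, Finset.sum_eq_single k]
      · simp
      · intro j _ hj
        rw [map_smul, show B (v k) (v j) = 0 from hv hj.symm, smul_zero]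
      · simp
    rw [h, mul_comm (v.repr x k), inv_mul_cancel_left₀ (hd k).ne']
  have hbrepr : ∀ x, ∑ i, B x (B.dualBasis hB b i) • b i = x := fun x => by
    conv_rhs => rw [← b.sum_repr x]
    refine Finset.sum_congr rfl fun i _ => ?_
    rw [← LinearMap.BilinForm.dualBasis_repr_apply hB,
      LinearMap.BilinForm.dualBasis_dualBasis hB hBs]
  refine ⟨fun k => (√(B (v k) (v k)))⁻¹ • v k, fun D => ?_⟩
  calc ∑ i, D (b i) (B.dualBasis hB b i)
      = ∑ i, ∑ k, (B (v k) (v k))⁻¹ • D (B (v k) (B.dualBasis hB b i) • b i) (v k) := by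
        refine Finset.sum_congr rfl fun i _ => ?_
        conv_lhs => rw [← v.sum_repr (B.dualBasis hB b i), map_sum]
        refine Finset.sum_congr rfl fun k _ => ?_
        rw [hrepr, map_smul, map_smul, LinearMap.smul_apply, mul_smul]
    _ = ∑ k, (B (v k) (v k))⁻¹ • D (∑ i, B (v k) (B.dualBasis hB b i) • b i) (v k) := by
        rw [Finset.sum_comm]
        simp_rw [map_sum, LinearMap.sum_apply, Finset.smul_sum]
    _ = _ := by
        refine Finset.sum_congr rfl fun k _ => ?_
        rw [hbrepr, map_smul, map_smul, LinearMap.smul_apply, smul_smul, ← mul_inv,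
          Real.mul_self_sqrt (hd k).le]

section Laplace

variable {E : Type*} [NormedAddCommGroup E] [NormedSpace ℝ E] [FiniteDimensional ℝ E]
  {H : Type*} [TopologicalSpace H] {I : ModelWithCorners ℝ E H} [I.Boundaryless]
  {G : Type*} [TopologicalSpace G] [ChartedSpace H G] [Group G] [LieGroup I ∞ G]

/-- The second-order derivatives of a smooth function at a point along left-invariant fields,
as a bilinear map on the Lie algebra. -/
noncomputable def lieHessian {f : G → ℂ} (hf : ContMDiff I 𝓘(ℝ, ℂ) ∞ f) (x : G) :
    GroupLieAlgebra I G →ₗ[ℝ] GroupLieAlgebra I G →ₗ[ℝ] ℂ :=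
  LinearMap.mk₂ ℝ (fun v w => lieDeriv v (lieDeriv w f) x)
    (fun v v' w => lieDeriv_add_left v v' _ x)
    (fun c v w => by rw [lieDeriv_smul_left, Complex.real_smul])
    (fun v w w' => by
      have h : lieDeriv (w + w') f = fun y => lieDeriv w f y + lieDeriv w' f y :=
        funext (lieDeriv_add_left w w' f)
      rw [h, lieDeriv_add v (contMDiff_lieDeriv w hf) (contMDiff_lieDeriv w' hf)])
    (fun c v w => by
      have h : lieDeriv (c • w) f = fun y => (c : ℂ) * lieDeriv w f y :=
        funext (lieDeriv_smul_left c w f)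
      rw [h, lieDeriv_const_mul v _ (contMDiff_lieDeriv w hf), Complex.real_smul])

/-- On smooth functions, the Laplace–Beltrami operator is a sum of squares of left-invariant
vector fields. -/
theorem exists_laplaceBeltrami_eq_sum_sq (m : BiInvariantMetric I G) :
    ∃ (n : ℕ) (e : Fin n → GroupLieAlgebra I G), ∀ f : G → ℂ, ContMDiff I 𝓘(ℝ, ℂ) ∞ f →
      laplaceBeltrami m f = fun x => ∑ k, lieDeriv (e k) (lieDeriv (e k) f) x := by
  have : FiniteDimensional ℝ (GroupLieAlgebra I G) := finiteDimensional_lieAlgebra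
  obtain ⟨e, he⟩ := exists_sum_dualBasis_eq m.form m.nondegenerate m.symm m.posDef
    (Module.finBasis ℝ (GroupLieAlgebra I G))
  exact ⟨_, e, fun f hf => funext fun x => he (lieHessian hf x)⟩

variable (m : BiInvariantMetric I G)

theorem contMDiff_laplaceBeltrami {f : G → ℂ} (hf : ContMDiff I 𝓘(ℝ, ℂ) ∞ f) :
    ContMDiff I 𝓘(ℝ, ℂ) ∞ (laplaceBeltrami m f) := by
  obtain ⟨n, e, he⟩ := exists_laplaceBeltrami_eq_sum_sq m
  rw [he f hf]
  exact ContMDiff.sum fun k _ => contMDiff_lieDeriv _ (contMDiff_lieDeriv _ hf)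

theorem laplaceBeltrami_add {f g : G → ℂ} (hf : ContMDiff I 𝓘(ℝ, ℂ) ∞ f)
    (hg : ContMDiff I 𝓘(ℝ, ℂ) ∞ g) :
    laplaceBeltrami m (fun y => f y + g y) =
      fun x => laplaceBeltrami m f x + laplaceBeltrami m g x := by
  obtain ⟨n, e, he⟩ := exists_laplaceBeltrami_eq_sum_sq m
  rw [he f hf, he g hg, he (fun y => f y + g y) (hf.add hg)]
  ext x
  simp_rw [lieDeriv_add _ hf hg,
    lieDeriv_add _ (contMDiff_lieDeriv _ hf) (contMDiff_lieDeriv _ hg), Finset.sum_add_distrib]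

theorem laplaceBeltrami_const_mul (c : ℂ) {f : G → ℂ} (hf : ContMDiff I 𝓘(ℝ, ℂ) ∞ f) :
    laplaceBeltrami m (fun y => c * f y) = fun x => c * laplaceBeltrami m f x := by
  obtain ⟨n, e, he⟩ := exists_laplaceBeltrami_eq_sum_sq m
  rw [he f hf, he _ (contMDiff_mul_complex contMDiff_const hf)]
  ext x
  simp_rw [lieDeriv_const_mul _ c hf, lieDeriv_const_mul _ c (contMDiff_lieDeriv _ hf),
    Finset.mul_sum]

theorem laplaceBeltrami_conj {f : G → ℂ} (hf : ContMDiff I 𝓘(ℝ, ℂ) ∞ f) :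
    laplaceBeltrami m (fun y => (starRingEnd ℂ) (f y)) =
      fun x => (starRingEnd ℂ) (laplaceBeltrami m f x) := by
  obtain ⟨n, e, he⟩ := exists_laplaceBeltrami_eq_sum_sq m
  rw [he f hf, he _ (contMDiff_conj hf)]
  ext x
  simp_rw [lieDeriv_conj _ hf, lieDeriv_conj _ (contMDiff_lieDeriv _ hf), map_sum]

variable [CompactSpace G] [SecondCountableTopology G] [MeasurableSpace G] [BorelSpace G]
  {μ : Measure G} [IsFiniteMeasure μ] [μ.IsMulRightInvariant]

theorem integral_laplaceBeltrami_mul {f g : G → ℂ} (hf : ContMDiff I 𝓘(ℝ, ℂ) ∞ f)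
    (hg : ContMDiff I 𝓘(ℝ, ℂ) ∞ g) :
    ∫ x, laplaceBeltrami m f x * g x ∂μ = ∫ x, f x * laplaceBeltrami m g x ∂μ := by
  obtain ⟨n, e, he⟩ := exists_laplaceBeltrami_eq_sum_sq m
  rw [he f hf, he g hg]
  simp_rw [Finset.sum_mul, Finset.mul_sum]
  have hf' := fun k => contMDiff_lieDeriv (e k) hf
  have hg' := fun k => contMDiff_lieDeriv (e k) hg
  rw [integral_finsetSum _ fun k _ => integrable_of_continuous
      (contMDiff_mul_complex (contMDiff_lieDeriv (e k) (hf' k)) hg).continuous,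
    integral_finsetSum _ fun k _ => integrable_of_continuous
      (contMDiff_mul_complex hf (contMDiff_lieDeriv (e k) (hg' k))).continuous]
  refine Finset.sum_congr rfl fun k _ => ?_
  rw [integral_lieDeriv_mul _ (hf' k) hg, integral_lieDeriv_mul _ hf (hg' k), neg_neg]

theorem integral_laplaceBeltrami_mul_conj_nonpos {f : G → ℂ} (hf : ContMDiff I 𝓘(ℝ, ℂ) ∞ f) :
    (∫ x, laplaceBeltrami m f x * (starRingEnd ℂ) (f x) ∂μ).re ≤ 0 := by
  obtain ⟨n, e, he⟩ := exists_laplaceBeltrami_eq_sum_sq m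
  rw [he f hf]
  simp_rw [Finset.sum_mul]
  have hf' := fun k => contMDiff_lieDeriv (e k) hf
  rw [integral_finsetSum _ fun k _ => integrable_of_continuous
      (contMDiff_mul_complex (contMDiff_lieDeriv (e k) (hf' k)) (contMDiff_conj hf)).continuous,
    Complex.re_sum]
  refine Finset.sum_nonpos fun k _ => ?_
  rw [integral_lieDeriv_mul _ (hf' k) (contMDiff_conj hf), lieDeriv_conj _ hf]
  simp_rw [Complex.mul_conj]
  rw [integral_complex_ofReal, Complex.neg_re, Complex.ofReal_re]
  exact neg_nonpos.2 (integral_nonneg fun x => Complex.normSq_nonneg _)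

end Laplace

/-! ### Convolution operators on a compact group -/

section InnerMap

variable {K : Type*} [TopologicalSpace K] [CompactSpace K]
  {F : Type*} [NormedAddCommGroup F] [InnerProductSpace ℂ F]

/-- The operator `f ↦ (x ↦ ⟪κ x, f⟫)` from a Hilbert space to continuous functions, given by a
continuous family `κ` of vectors. -/
noncomputable def innerFamily (κ : C(K, F)) : F →L[ℂ] C(K, ℂ) :=
  LinearMap.mkContinuous
    { toFun := fun f => ⟨fun x => inner ℂ (κ x) f, by fun_prop⟩
      map_add' := fun f g => by ext x; simp
      map_smul' := fun c f => by ext x; simp } ‖κ‖ (fun f => by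
    rw [ContinuousMap.norm_le _ (by positivity)]
    intro x
    exact (norm_inner_le_norm _ _).trans (by gcongr; exact κ.norm_coe_le_norm x))

/-- The image of the unit ball is bounded and equicontinuous, so the Arzelà–Ascoli theorem
applies. -/
theorem isCompactOperator_innerFamily (κ : C(K, F)) : IsCompactOperator (innerFamily κ) := by
  let e := ContinuousMap.linearIsometryBoundedOfCompact K ℂ ℂ
  let A : Set (BoundedContinuousFunction K ℂ) := e '' (innerFamily κ '' Metric.ball 0 1)
  have hA : ∀ g ∈ A, ∃ f : F, ‖f‖ < 1 ∧ ∀ x, g x = inner ℂ (κ x) f := by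
    rintro _ ⟨_, ⟨f, hf, rfl⟩, rfl⟩
    exact ⟨f, by simpa using hf, fun x => rfl⟩
  have hAc : IsCompact (closure A) := by
    refine BoundedContinuousFunction.arzela_ascoli (Metric.closedBall 0 ‖κ‖)
      (isCompact_closedBall _ _) A ?_ ?_
    · intro g x hg
      obtain ⟨f, hf, hgf⟩ := hA g hg
      rw [mem_closedBall_zero_iff, hgf]
      calc ‖inner ℂ (κ x) f‖ ≤ ‖κ x‖ * ‖f‖ := norm_inner_le_norm _ _
        _ ≤ ‖κ‖ * 1 := by gcongr; exact κ.norm_coe_le_norm x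
        _ = ‖κ‖ := mul_one _
    · intro x₀
      refine Metric.equicontinuousAt_of_continuity_modulus (fun x => ‖κ x₀ - κ x‖) ?_ _ ?_
      · have : Continuous fun x => ‖κ x₀ - κ x‖ := by fun_prop
        simpa using this.tendsto x₀
      · refine .of_forall fun x ⟨g, hg⟩ => ?_
        obtain ⟨f, hf, hgf⟩ := hA g hg
        change dist (g x₀) (g x) ≤ _
        rw [hgf, hgf, dist_eq_norm, ← inner_sub_left]
        calc ‖inner ℂ (κ x₀ - κ x) f‖ ≤ ‖κ x₀ - κ x‖ * ‖f‖ := norm_inner_le_norm _ _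
          _ ≤ ‖κ x₀ - κ x‖ * 1 := by gcongr
          _ = _ := mul_one _
  refine (isCompactOperator_iff_image_ball_subset_compact (innerFamily κ : F →ₗ[ℂ] C(K, ℂ))
    one_pos).2 ⟨e.symm '' closure A, hAc.image e.symm.continuous, ?_⟩
  rintro _ ⟨f, hf, rfl⟩
  exact ⟨e (innerFamily κ f), subset_closure ⟨_, ⟨f, hf, rfl⟩, rfl⟩, e.symm_apply_apply _⟩

end InnerMap

section ContToL2

theorem integrable_L2 {α : Type*} [MeasurableSpace α] {μ : Measure α} [IsFiniteMeasure μ]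
    (f : Lp ℂ 2 μ) : Integrable f μ :=
  (Lp.memLp f).integrable (by norm_num)

variable {K : Type*} [TopologicalSpace K] [CompactSpace K] [MeasurableSpace K] [BorelSpace K]
  (μ : Measure K) [IsFiniteMeasure μ]

/-- The class in `L²` of a continuous function on a compact space. -/
noncomputable abbrev contToL2 : C(K, ℂ) →L[ℂ] Lp ℂ 2 μ := ContinuousMap.toLp 2 μ ℂ

variable {μ}

theorem inner_contToL2_left (g : C(K, ℂ)) (f : Lp ℂ 2 μ) :
    inner ℂ (contToL2 μ g) f = ∫ y, (starRingEnd ℂ) (g y) * f y ∂μ := by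
  rw [L2.inner_def]
  refine integral_congr_ae ?_
  filter_upwards [ContinuousMap.coeFn_toLp (p := 2) (𝕜 := ℂ) μ g] with y hy
  rw [hy, RCLike.inner_apply, mul_comm]

end ContToL2

section Convolution

variable {G : Type*} [TopologicalSpace G] [CompactSpace G] [Group G] [IsTopologicalGroup G]
  [MeasurableSpace G] [BorelSpace G] (μ : Measure G) [IsFiniteMeasure μ]

/-- The family of vectors `y ↦ conj (ρ (x y⁻¹))` of `L²`, indexed by `x`. -/
noncomputable def convKernel (ρ : C(G, ℂ)) : C(G, Lp ℂ 2 μ) :=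
  (contToL2 μ : C(C(G, ℂ), Lp ℂ 2 μ)).comp
    (ContinuousMap.curry ⟨fun q : G × G => (starRingEnd ℂ) (ρ (q.1 * q.2⁻¹)),
      Complex.continuous_conj.comp (by fun_prop)⟩)

/-- The convolution `x ↦ ∫ ρ (x y⁻¹) f y dy` of a continuous function with a function in `L²`. -/
noncomputable def convFun (ρ : C(G, ℂ)) : Lp ℂ 2 μ →L[ℂ] C(G, ℂ) :=
  innerFamily (convKernel μ ρ)

/-- Convolution with a continuous function, as an operator on `L²`. -/
noncomputable def convOp (ρ : C(G, ℂ)) : Lp ℂ 2 μ →L[ℂ] Lp ℂ 2 μ :=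
  (contToL2 μ).comp (convFun μ ρ)

variable {μ}

theorem convFun_apply (ρ : C(G, ℂ)) (f : Lp ℂ 2 μ) (x : G) :
    convFun μ ρ f x = ∫ y, ρ (x * y⁻¹) * f y ∂μ := by
  refine (inner_contToL2_left _ f).trans ?_
  simp

theorem convFun_contToL2_apply (ρ f : C(G, ℂ)) (x : G) :
    convFun μ ρ (contToL2 μ f) x = ∫ y, ρ (x * y⁻¹) * f y ∂μ := by
  rw [convFun_apply]
  refine integral_congr_ae ?_
  filter_upwards [ContinuousMap.coeFn_toLp (p := 2) (𝕜 := ℂ) μ f] with y hy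
  rw [hy]

theorem isCompactOperator_convOp (ρ : C(G, ℂ)) : IsCompactOperator (convOp μ ρ) :=
  (isCompactOperator_innerFamily (convKernel μ ρ)).clm_comp (contToL2 μ)

/-- An element of an eigenspace of a convolution operator for a nonzero eigenvalue is represented
by a continuous function. -/
theorem contToL2_inv_smul_convFun {ρ : C(G, ℂ)} {c : ℂ} (hc : c ≠ 0) {f : Lp ℂ 2 μ}
    (hf : convOp μ ρ f = c • f) : contToL2 μ (c⁻¹ • convFun μ ρ f) = f := by
  have h : contToL2 μ (convFun μ ρ f) = c • f := hf
  rw [map_smul, h, smul_smul, inv_mul_cancel₀ hc, one_smul]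

theorem isSymmetric_convOp [SecondCountableTopology G] {ρ : C(G, ℂ)}
    (hρ : ∀ z, (starRingEnd ℂ) (ρ z⁻¹) = ρ z) : (convOp μ ρ).IsSymmetric := by
  intro f g
  change inner ℂ (contToL2 μ (convFun μ ρ f)) g = inner ℂ f (contToL2 μ (convFun μ ρ g))
  rw [← inner_conj_symm f, inner_contToL2_left, inner_contToL2_left, ← integral_conj]
  simp_rw [convFun_apply, map_mul, Complex.conj_conj, ← integral_conj, ← integral_mul_const,
    map_mul]
  have hint : Integrable (fun q : G × G => ρ (q.2 * q.1⁻¹) *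
      ((starRingEnd ℂ) (f q.2) * g q.1)) (μ.prod μ) := by
    have h1 : Integrable (fun q : G × G => (starRingEnd ℂ) (f q.2) * g q.1) (μ.prod μ) := by
      have := (integrable_L2 g).mul_prod
        ((Complex.conjCLE : ℂ →L[ℝ] ℂ).integrable_comp (integrable_L2 f))
      refine this.congr (.of_forall fun q => ?_)
      simp [mul_comm]
    have hcont : Continuous fun q : G × G => ρ (q.2 * q.1⁻¹) := by fun_prop
    exact h1.bdd_mul (c := ‖ρ‖) hcont.aestronglyMeasurable
      (.of_forall fun q => ρ.norm_coe_le_norm _)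
  calc ∫ x, ∫ y, (starRingEnd ℂ) (ρ (x * y⁻¹)) * (starRingEnd ℂ) (f y) * g x ∂μ ∂μ
      = ∫ x, ∫ y, ρ (y * x⁻¹) * ((starRingEnd ℂ) (f y) * g x) ∂μ ∂μ := by
        congr 1 with x
        congr 1 with y
        rw [← hρ (y * x⁻¹), mul_inv_rev, inv_inv, mul_assoc]
    _ = ∫ y, ∫ x, ρ (y * x⁻¹) * ((starRingEnd ℂ) (f y) * g x) ∂μ ∂μ :=
        integral_integral_swap hint
    _ = _ := by
        congr 1 with y
        congr 1 with x
        ring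

/-- Convolution with a nonnegative function concentrated near the identity approximates a
multiple of the identity on continuous functions. -/
theorem norm_convFun_sub_le [μ.IsMulRightInvariant] {ρ : C(G, ℂ)} {r : G → ℝ}
    (hr : ∀ z, ρ z = r z) (hr0 : ∀ z, 0 ≤ r z) (hsymm : ∀ z, r z⁻¹ = r z) (ψ : C(G, ℂ))
    {ε : ℝ} (hε : 0 ≤ ε) (h : ∀ x y, r (x * y⁻¹) ≠ 0 → ‖ψ y - ψ x‖ ≤ ε) :
    ‖convFun μ ρ (contToL2 μ ψ) - ((∫ z, r z ∂μ : ℝ) : ℂ) • ψ‖ ≤ ε * ∫ z, r z ∂μ := by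
  have hrc : Continuous r := by
    have : r = fun z => (ρ z).re := by ext z; simp [hr]
    rw [this]
    fun_prop
  have hint : ∀ x, ∫ y, r (x * y⁻¹) ∂μ = ∫ z, r z ∂μ := fun x => by
    rw [← integral_mul_right_eq_self (fun y => r (x * y⁻¹)) x]
    simp [hsymm]
  rw [ContinuousMap.norm_le _ (mul_nonneg hε (integral_nonneg hr0))]
  intro x
  have h1 : (convFun μ ρ (contToL2 μ ψ) - ((∫ z, r z ∂μ : ℝ) : ℂ) • ψ) x =
      ∫ y, (r (x * y⁻¹) : ℂ) * (ψ y - ψ x) ∂μ := by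
    rw [ContinuousMap.sub_apply, convFun_contToL2_apply, ContinuousMap.smul_apply, ← hint x,
      ← integral_complex_ofReal, smul_eq_mul, ← integral_mul_const, ← integral_sub]
    · simp_rw [hr, mul_sub]
    · exact integrable_of_continuous (by fun_prop)
    · exact integrable_of_continuous (by fun_prop)
  rw [h1, ← hint x, ← integral_const_mul]
  refine norm_integral_le_of_norm_le ?_ (.of_forall fun y => ?_)
  · exact (Continuous.integrable_of_hasCompactSupport (by fun_prop)
      (HasCompactSupport.of_compactSpace _))
  · rw [norm_mul, Complex.norm_real, Real.norm_of_nonneg (hr0 _), mul_comm]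
    by_cases h0 : r (x * y⁻¹) = 0
    · simp [h0]
    · exact mul_le_mul_of_nonneg_right (h x y h0) (hr0 _)

end Convolution

section SmoothConvolution

variable {E : Type*} [NormedAddCommGroup E] [NormedSpace ℝ E] [FiniteDimensional ℝ E]
  {H : Type*} [TopologicalSpace H] {I : ModelWithCorners ℝ E H}
  {G : Type*} [TopologicalSpace G] [CompactSpace G] [ChartedSpace H G] [Group G]
  [LieGroup I ∞ G]

variable (I) in
/-- There are smooth symmetric nonnegative functions concentrated so near the identity that `ψ`
varies by at most `ε` on their supports, translated to any point. -/
theorem exists_approxIdentity [T2Space G] [IsTopologicalGroup G] (ψ : C(G, ℂ)) {ε : ℝ}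
    (hε : 0 < ε) :
    ∃ r : G → ℝ, ContMDiff I 𝓘(ℝ, ℝ) ∞ r ∧ (∀ z, 0 ≤ r z) ∧ (∀ z, r z⁻¹ = r z) ∧ r 1 ≠ 0 ∧
      ∀ x y, r (x * y⁻¹) ≠ 0 → ‖ψ y - ψ x‖ ≤ ε := by
  have hU : ∀ᶠ z in 𝓝 (1 : G), ∀ x ∈ (univ : Set G), ‖ψ (z⁻¹ * x) - ψ x‖ < ε := by
    refine isCompact_univ.eventually_forall_of_forall_eventually fun x _ => ?_
    have hc : Continuous fun q : G × G => ‖ψ (q.1⁻¹ * q.2) - ψ q.2‖ := by fun_prop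
    exact (hc.tendsto (1, x)).eventually (gt_mem_nhds (by simpa using hε))
  have hV : ∀ᶠ z in 𝓝 (1 : G), ∀ x ∈ (univ : Set G), ‖ψ (z⁻¹⁻¹ * x) - ψ x‖ < ε := by
    have := continuous_inv.tendsto (1 : G)
    rw [inv_one] at this
    exact this.eventually hU
  obtain ⟨f, -, hf⟩ := (SmoothBumpFunction.nhds_basis_tsupport (I := I) (1 : G)).mem_iff.1
    (inter_mem hU hV)
  have hf' : ∀ z, f z ≠ 0 → ∀ x, ‖ψ (z⁻¹ * x) - ψ x‖ < ε ∧ ‖ψ (z * x) - ψ x‖ < ε :=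
    fun z hz x => by
      have := hf (subset_tsupport _ hz)
      exact ⟨this.1 x trivial, by simpa using this.2 x trivial⟩
  refine ⟨fun z => f z + f z⁻¹, f.contMDiff.add (f.contMDiff.comp (contMDiff_inv I ∞)),
    fun z => add_nonneg f.nonneg f.nonneg, fun z => by simp only [inv_inv, add_comm], ?_, ?_⟩
  · simp
  · intro x y h
    have hy : ψ y = ψ ((x * y⁻¹)⁻¹ * x) := by simp
    rw [hy]
    by_cases h0 : f (x * y⁻¹) = 0
    · have h1 : f (x * y⁻¹)⁻¹ ≠ 0 := fun h1 => h (by simp only [h0, h1, add_zero])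
      exact (hf' _ h1 x).2.le
    · exact (hf' _ h0 x).1.le

variable [I.Boundaryless] [SecondCountableTopology G] [IsTopologicalGroup G]
  [MeasurableSpace G] [BorelSpace G] {μ : Measure G} [IsFiniteMeasure μ]

/-- Near a point the convolution is the pullback by a chart of a smooth parametric integral over
the model space. -/
theorem contMDiff_convFun {ρ : C(G, ℂ)} (hρ : ContMDiff I 𝓘(ℝ, ℂ) ∞ ρ) (f : Lp ℂ 2 μ) :
    ContMDiff I 𝓘(ℝ, ℂ) ∞ (convFun μ ρ f) := by
  intro x₀
  obtain ⟨Γ, hΓ, -, hΓid⟩ := exists_contMDiff_parametrization I x₀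
  have hF : ContMDiff (𝓘(ℝ, E).prod I) 𝓘(ℝ, ℂ) ∞
      (Function.uncurry fun (e : E) (y : G) => ρ (Γ e * y⁻¹)) :=
    hρ.comp ((hΓ.comp contMDiff_fst).mul ((contMDiff_inv I ∞).comp contMDiff_snd))
  have h1 := (contDiff_integral_mul hF (integrable_L2 f)).contMDiff.contMDiffAt.comp x₀
    (contMDiffAt_extChartAt (I := I) (n := ∞) (x := x₀))
  refine h1.congr_of_eventuallyEq ?_
  filter_upwards [hΓid] with x hx
  rw [convFun_apply, Function.comp_apply, hx]
  simp_rw [mul_comm]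

/-- Convolution commutes with right translations, hence with the derivatives along left-invariant
fields. -/
theorem convolution_lieDeriv [μ.IsMulRightInvariant] {ρ : C(G, ℂ)} {f : G → ℂ} {c : ℂ}
    (hf : ContMDiff I 𝓘(ℝ, ℂ) ∞ f) (h : ∀ x, ∫ y, ρ (x * y⁻¹) * f y ∂μ = c * f x)
    (v : GroupLieAlgebra I G) (x : G) :
    ∫ y, ρ (x * y⁻¹) * lieDeriv v f y ∂μ = c * lieDeriv v f x := by
  obtain ⟨γ, h1, h2, h3⟩ := exists_curve_lieDeriv v
  have h4 := hasDerivAt_integral_mul_curve (μ := μ) h1 h3 hf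
    (w := fun y => ρ (x * y⁻¹)) (integrable_of_continuous (by fun_prop))
  have h5 : ∀ t, ∫ y, ρ (x * y⁻¹) * f (y * γ t) ∂μ = c * f (x * γ t) := fun t => by
    rw [← h, ← integral_mul_right_eq_self (fun y => ρ (x * γ t * y⁻¹) * f y) (γ t)]
    simp [mul_assoc]
  simp_rw [h5] at h4
  exact h4.unique ((h3 f x (hf.mdifferentiable (by simp) x)).const_mul c)

theorem convolution_laplaceBeltrami [μ.IsMulRightInvariant] (m : BiInvariantMetric I G)
    {ρ : C(G, ℂ)} {f : G → ℂ} {c : ℂ} (hf : ContMDiff I 𝓘(ℝ, ℂ) ∞ f)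
    (h : ∀ x, ∫ y, ρ (x * y⁻¹) * f y ∂μ = c * f x) (x : G) :
    ∫ y, ρ (x * y⁻¹) * laplaceBeltrami m f y ∂μ = c * laplaceBeltrami m f x := by
  obtain ⟨n, e, he⟩ := exists_laplaceBeltrami_eq_sum_sq m
  rw [he f hf]
  have hf' := fun k => contMDiff_lieDeriv (e k) hf
  have hf'' := fun k => (contMDiff_lieDeriv (e k) (hf' k)).continuous
  simp_rw [Finset.mul_sum]
  rw [integral_finsetSum _ fun k _ => integrable_of_continuous (by
    have := hf'' k
    fun_prop)]
  exact Finset.sum_congr rfl fun k _ =>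
    convolution_lieDeriv (hf' k) (convolution_lieDeriv hf h (e k)) (e k) x

end SmoothConvolution

/-! ### Completeness of the eigenfunctions of the Laplace–Beltrami operator -/

section Completeness

variable {E : Type*} [NormedAddCommGroup E] [NormedSpace ℝ E] [FiniteDimensional ℝ E]
  {H : Type*} [TopologicalSpace H] {I : ModelWithCorners ℝ E H}
  {G : Type*} [TopologicalSpace G] [CompactSpace G] [ChartedSpace H G] [Group G]
  [MeasurableSpace G] [BorelSpace G] {μ : Measure G} [IsFiniteMeasure μ]
  (m : BiInvariantMetric I G)

theorem mem_eigenspace_of_eq {a : ℝ≥0} (f : C(G, ℂ)) (hf : ContMDiff I 𝓘(ℝ, ℂ) ∞ f)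
    (h : ∀ x, -laplaceBeltrami m f x = ((a : ℝ) : ℂ) * f x) :
    contToL2 μ f ∈ eigenspace m μ a :=
  Submodule.le_topologicalClosure _ (Submodule.subset_span
    ⟨f, hf, h, ContinuousMap.coeFn_toLp (p := 2) (𝕜 := ℂ) μ f⟩)

variable [I.Boundaryless] [LieGroup I ∞ G] [SecondCountableTopology G]

/-- A real eigenvalue of `L` with a nonzero smooth eigenfunction is nonpositive. -/
theorem nonpos_of_laplaceBeltrami_eq [μ.IsMulRightInvariant] {f : C(G, ℂ)}
    (hf : ContMDiff I 𝓘(ℝ, ℂ) ∞ f) (hf0 : contToL2 μ f ≠ 0) {b : ℝ}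
    (h : ∀ x, laplaceBeltrami m f x = (b : ℂ) * f x) : b ≤ 0 := by
  have h1 := integral_laplaceBeltrami_mul_conj_nonpos (μ := μ) m hf
  have h2 : ∫ x, laplaceBeltrami m f x * (starRingEnd ℂ) (f x) ∂μ =
      (b : ℂ) * inner ℂ (contToL2 μ f) (contToL2 μ f) := by
    rw [ContinuousMap.inner_toLp, ← integral_const_mul]
    simp_rw [h, mul_assoc]
  rw [h2, inner_self_eq_norm_sq_to_K, Complex.re_ofReal_mul] at h1
  have h3 : 0 < ‖contToL2 μ f‖ ^ 2 := by positivity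
  have h4 : ((‖contToL2 μ f‖ : ℂ) ^ 2).re = ‖contToL2 μ f‖ ^ 2 := by
    rw [← Complex.ofReal_pow, Complex.ofReal_re]
  by_contra! hb
  have : b * ((‖contToL2 μ f‖ : ℂ) ^ 2).re ≤ 0 := h1
  rw [h4] at this
  nlinarith

variable [IsTopologicalGroup G]

theorem contMDiff_const_mul_convFun {ρ : C(G, ℂ)} (hρ : ContMDiff I 𝓘(ℝ, ℂ) ∞ ρ) (c : ℂ)
    (f : Lp ℂ 2 μ) : ContMDiff I 𝓘(ℝ, ℂ) ∞ fun x => c * convFun μ ρ f x :=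
  contMDiff_mul_complex contMDiff_const (contMDiff_convFun hρ f)

/-- The Laplace–Beltrami operator on the image of convolution with a smooth function,
as an operator on `L²`: `f ↦ L (c • ρ * f)`. -/
noncomputable def laplaceConv {ρ : C(G, ℂ)} (hρ : ContMDiff I 𝓘(ℝ, ℂ) ∞ ρ) (c : ℂ) :
    Lp ℂ 2 μ →ₗ[ℂ] C(G, ℂ) where
  toFun f := ⟨laplaceBeltrami m fun x => c * convFun μ ρ f x,
    (contMDiff_laplaceBeltrami m (contMDiff_const_mul_convFun hρ c f)).continuous⟩
  map_add' f g := by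
    ext x
    simp only [map_add, ContinuousMap.add_apply, mul_add, ContinuousMap.coe_mk]
    rw [laplaceBeltrami_add m (contMDiff_const_mul_convFun hρ c f)
      (contMDiff_const_mul_convFun hρ c g)]
  map_smul' a f := by
    ext x
    simp only [map_smul, ContinuousMap.smul_apply, smul_eq_mul, ContinuousMap.coe_mk,
      RingHom.id_apply, mul_left_comm c a]
    rw [laplaceBeltrami_const_mul m a (contMDiff_const_mul_convFun hρ c f)]

variable [μ.IsMulRightInvariant]

/-- A finite-dimensional subspace that carries a symmetric operator is contained in every subspace
that contains the eigenvectors of the operator for real eigenvalues. -/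
theorem le_of_eigenvectors_mem {F : Type*} [NormedAddCommGroup F] [InnerProductSpace ℂ F]
    {V P : Submodule ℂ F} [FiniteDimensional ℂ V] {L : V →ₗ[ℂ] V} (hL : L.IsSymmetric)
    (h : ∀ (b : ℝ) (f : V), f ≠ 0 → L f = (b : ℂ) • f → (f : F) ∈ P) : V ≤ P := by
  let e := hL.eigenvectorBasis rfl
  intro f hf
  have h1 : ∑ i, e.repr ⟨f, hf⟩ i • (e i : F) = f := by
    have := congrArg V.subtype (e.sum_repr ⟨f, hf⟩)
    simpa only [map_sum, map_smul, Submodule.subtype_apply] using this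
  rw [← h1]
  exact Submodule.sum_mem _ fun i _ => Submodule.smul_mem _ _
    (h _ _ (e.orthonormal.ne_zero i) (hL.apply_eigenvectorBasis rfl i))

/-- An element `f` of the eigenspace of convolution with `ρ` for an eigenvalue `c ≠ 0` is
represented by the smooth function `c⁻¹ • ρ * f`, so that `L f` is `laplaceConv m hρ c⁻¹ f`. It lies
in the same eigenspace. -/
theorem convOp_laplaceConv {ρ : C(G, ℂ)} (hρ : ContMDiff I 𝓘(ℝ, ℂ) ∞ ρ) {c : ℂ} (hc : c ≠ 0)
    {f : Lp ℂ 2 μ} (hf : convOp μ ρ f = c • f) :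
    convOp μ ρ (contToL2 μ (laplaceConv m hρ c⁻¹ f)) =
      c • contToL2 μ (laplaceConv m hρ c⁻¹ f) := by
  change contToL2 μ (convFun μ ρ (contToL2 μ (laplaceConv m hρ c⁻¹ f))) = _
  rw [← map_smul]
  congr 1
  ext x
  have h : ∀ x, ∫ y, ρ (x * y⁻¹) * (c⁻¹ * convFun μ ρ f y) ∂μ = c * (c⁻¹ * convFun μ ρ f x) :=
    fun x => by
      rw [mul_inv_cancel_left₀ hc]
      conv_rhs => rw [← contToL2_inv_smul_convFun hc hf, convFun_contToL2_apply]
      rfl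
  rw [convFun_contToL2_apply]
  exact convolution_laplaceBeltrami m (contMDiff_const_mul_convFun hρ c⁻¹ f) h x

theorem inner_laplaceConv {ρ : C(G, ℂ)} (hρ : ContMDiff I 𝓘(ℝ, ℂ) ∞ ρ) {c : ℂ} (hc : c ≠ 0)
    {f g : Lp ℂ 2 μ} (hf : convOp μ ρ f = c • f) (hg : convOp μ ρ g = c • g) :
    inner ℂ (contToL2 μ (laplaceConv m hρ c⁻¹ f)) g =
      inner ℂ f (contToL2 μ (laplaceConv m hρ c⁻¹ g)) := by
  conv_lhs => rw [← contToL2_inv_smul_convFun hc hg]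
  conv_rhs => rw [← contToL2_inv_smul_convFun hc hf]
  rw [ContinuousMap.inner_toLp, ContinuousMap.inner_toLp]
  have hfs := contMDiff_const_mul_convFun hρ c⁻¹ f
  have h := integral_laplaceBeltrami_mul (μ := μ) m (contMDiff_conj hfs)
    (contMDiff_const_mul_convFun hρ c⁻¹ g)
  rw [laplaceBeltrami_conj m hfs] at h
  calc _ = ∫ x, (starRingEnd ℂ) (laplaceBeltrami m (fun y => c⁻¹ * convFun μ ρ f y) x) *
        (c⁻¹ * convFun μ ρ g x) ∂μ := by
        congr 1 with x
        exact mul_comm _ _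
    _ = _ := h
    _ = _ := by
        congr 1 with x
        exact mul_comm _ _

/-- An eigenspace of a convolution operator for a nonzero eigenvalue is a finite-dimensional space
of smooth functions on which `L` acts as a symmetric operator, so that it is spanned by smooth
eigenfunctions of `L`. -/
theorem convOp_eigenspace_le [μ.IsOpenPosMeasure] {ρ : C(G, ℂ)}
    (hρ : ContMDiff I 𝓘(ℝ, ℂ) ∞ ρ) {c : ℂ} (hc : c ≠ 0) :
    Module.End.eigenspace (convOp μ ρ : Lp ℂ 2 μ →ₗ[ℂ] Lp ℂ 2 μ) c ≤ ⨆ a, eigenspace m μ a := by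
  have : FiniteDimensional ℂ (Module.End.eigenspace (convOp μ ρ : Lp ℂ 2 μ →ₗ[ℂ] Lp ℂ 2 μ) c) :=
    ContinuousLinearMap.finite_dimensional_eigenspace (isCompactOperator_convOp ρ) c hc
  have hV : ∀ f ∈ Module.End.eigenspace (convOp μ ρ : Lp ℂ 2 μ →ₗ[ℂ] Lp ℂ 2 μ) c,
      convOp μ ρ f = c • f := fun f hf => Module.End.mem_eigenspace_iff.1 hf
  let L := ((contToL2 μ : C(G, ℂ) →ₗ[ℂ] Lp ℂ 2 μ).comp (laplaceConv m hρ c⁻¹)).restrict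
    (p := Module.End.eigenspace (convOp μ ρ : Lp ℂ 2 μ →ₗ[ℂ] Lp ℂ 2 μ) c)
    (q := Module.End.eigenspace (convOp μ ρ : Lp ℂ 2 μ →ₗ[ℂ] Lp ℂ 2 μ) c)
    fun f hf => Module.End.mem_eigenspace_iff.2 (convOp_laplaceConv m hρ hc (hV f hf))
  have hL : L.IsSymmetric := fun f g => inner_laplaceConv m hρ hc (hV f f.2) (hV g g.2)
  refine le_of_eigenvectors_mem hL fun b f hf0 hf => ?_
  have hrep := contToL2_inv_smul_convFun hc (hV f f.2)
  have hsm : ContMDiff I 𝓘(ℝ, ℂ) ∞ (c⁻¹ • convFun μ ρ (f : Lp ℂ 2 μ)) :=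
    contMDiff_const_mul_convFun hρ c⁻¹ (f : Lp ℂ 2 μ)
  have h1 : ∀ x, laplaceBeltrami m ⇑(c⁻¹ • convFun μ ρ (f : Lp ℂ 2 μ)) x =
      (b : ℂ) * (c⁻¹ • convFun μ ρ (f : Lp ℂ 2 μ)) x := by
    have h2 : contToL2 μ (laplaceConv m hρ c⁻¹ (f : Lp ℂ 2 μ)) =
        contToL2 μ ((b : ℂ) • c⁻¹ • convFun μ ρ (f : Lp ℂ 2 μ)) := by
      rw [map_smul, hrep]
      exact congrArg Subtype.val hf
    intro x
    exact congrArg (fun F : C(G, ℂ) => F x) (ContinuousMap.toLp_injective μ h2)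
  have hb : b ≤ 0 := nonpos_of_laplaceBeltrami_eq (μ := μ) m hsm
    (by rw [hrep]; exact fun h => hf0 (Subtype.ext h)) h1
  have h5 := mem_eigenspace_of_eq (μ := μ) (a := (-b).toNNReal) m _ hsm
    (fun x => by rw [h1, Real.coe_toNNReal _ (by linarith), Complex.ofReal_neg, neg_mul])
  rw [hrep] at h5
  exact Submodule.mem_iSup_of_mem _ h5

/-- The smooth eigenfunctions of `-L` are total in `L²`: a function orthogonal to all of them is
annihilated by all convolutions with smooth symmetric functions, hence by an approximate
identity. -/
theorem iSup_eigenspace_orthogonal [T2Space G] [μ.IsOpenPosMeasure] :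
    (⨆ a, eigenspace m μ a)ᗮ = ⊥ := by
  rw [Submodule.eq_bot_iff]
  intro w hw
  have hconv : ∀ ρ : C(G, ℂ), ContMDiff I 𝓘(ℝ, ℂ) ∞ ρ → (∀ z, (starRingEnd ℂ) (ρ z⁻¹) = ρ z) →
      convOp μ ρ w = 0 := fun ρ hρ hρs => by
    have hsymm := isSymmetric_convOp (μ := μ) hρs
    have h := ContinuousLinearMap.orthogonalComplement_iSup_eigenspaces_eq_bot
      (isCompactOperator_convOp (μ := μ) ρ) hsymm
    rw [← Submodule.mem_bot ℂ, ← h, Submodule.mem_orthogonal]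
    intro g hg
    induction hg using Submodule.iSup_induction' with
    | zero => simp
    | add g g' _ _ h1 h2 => rw [inner_add_left, h1, h2, add_zero]
    | mem c g hg =>
      have h1 : convOp μ ρ g = c • g := Module.End.mem_eigenspace_iff.1 hg
      have h2 : inner ℂ (convOp μ ρ g) w = inner ℂ g (convOp μ ρ w) := hsymm g w
      rw [← h2, h1, inner_smul_left]
      by_cases hc : c = 0
      · simp [hc]
      · rw [(Submodule.mem_orthogonal _ _).1 hw g (convOp_eigenspace_le m hρ hc hg), mul_zero]
  -- otherwise `ρ * ψ` is close enough to a multiple of `ψ` for some `ρ` to contradict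
  -- `⟪w, ρ * ψ⟫ = ⟪ρ * w, ψ⟫ = 0`
  have hψ : ∀ ψ : C(G, ℂ), inner ℂ w (contToL2 μ ψ) = 0 := fun ψ => by
    by_contra hne
    set δ := ‖inner ℂ w (contToL2 μ ψ)‖ with hδ
    have hδ0 : 0 < δ := norm_pos_iff.2 hne
    set N := ‖w‖ * ‖contToL2 μ‖ + 1 with hN
    have hN0 : 0 < N := by positivity
    obtain ⟨r, hr, hr0, hrs, hr1, hrψ⟩ := exists_approxIdentity I ψ
      (show 0 < δ / (2 * N) by positivity)
    have hρsm : ContMDiff I 𝓘(ℝ, ℂ) ∞ fun z => (r z : ℂ) :=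
      (Complex.ofRealCLM.contDiff (n := ∞)).contMDiff.comp hr
    let ρ : C(G, ℂ) := ⟨fun z => (r z : ℂ), hρsm.continuous⟩
    have hc0 : 0 < ∫ z, r z ∂μ :=
      hr.continuous.integral_pos_of_hasCompactSupport_nonneg_nonzero
        (HasCompactSupport.of_compactSpace _) hr0 hr1
    set c := ∫ z, r z ∂μ
    have hρs : ∀ z, (starRingEnd ℂ) (ρ z⁻¹) = ρ z := fun z => by simp [ρ, hrs]
    have h1 := norm_convFun_sub_le (μ := μ) (ρ := ρ) (fun z => rfl) hr0 hrs ψ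
      (show 0 ≤ δ / (2 * N) by positivity) hrψ
    have h2 : inner ℂ w (contToL2 μ (convFun μ ρ (contToL2 μ ψ))) = 0 := by
      have := isSymmetric_convOp (μ := μ) hρs w (contToL2 μ ψ)
      have h3 : inner ℂ (convOp μ ρ w) (contToL2 μ ψ) =
        inner ℂ w (convOp μ ρ (contToL2 μ ψ)) := this
      rw [hconv ρ hρsm hρs, inner_zero_left] at h3
      exact h3.symm
    have h4 : c * δ ≤ ‖w‖ * (‖contToL2 μ‖ * (δ / (2 * N) * c)) := by
      calc c * δ = ‖inner ℂ w (contToL2 μ (convFun μ ρ (contToL2 μ ψ) - (c : ℂ) • ψ))‖ := by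
            rw [map_sub, inner_sub_right, h2, zero_sub, norm_neg, map_smul, inner_smul_right,
              norm_mul, Complex.norm_real, Real.norm_of_nonneg hc0.le]
        _ ≤ ‖w‖ * ‖contToL2 μ (convFun μ ρ (contToL2 μ ψ) - (c : ℂ) • ψ)‖ :=
            norm_inner_le_norm _ _
        _ ≤ _ := by
            gcongr
            exact (ContinuousLinearMap.le_opNorm _ _).trans (by gcongr)
    have h5 : ‖w‖ * (‖contToL2 μ‖ * (δ / (2 * N) * c)) ≤ N * (δ / (2 * N) * c) := by
      rw [← mul_assoc]
      gcongr
      linarith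
    have h6 : N * (δ / (2 * N) * c) = c * δ / 2 := by field_simp
    have : 0 < c * δ := by positivity
    linarith
  have hdense : DenseRange (contToL2 μ) :=
    ContinuousMap.toLp_denseRange ℂ μ ℂ (by norm_num)
  have h : (fun g : Lp ℂ 2 μ => inner ℂ w g) = fun _ => 0 :=
    hdense.equalizer (by fun_prop) continuous_const (funext hψ)
  exact inner_self_eq_zero.1 (congrFun h w)

end Completeness

/-! ### Orthogonal decompositions of a Hilbert space -/

section HilbertSum

variable {F : Type*} [NormedAddCommGroup F] [InnerProductSpace ℂ F]
  {ι : Type*} {K : ι → Submodule ℂ F} [∀ i, CompleteSpace (K i)]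

theorem starProjection_eq_of_hasSum
    (hK : OrthogonalFamily ℂ (fun i => K i) fun i => (K i).subtypeₗᵢ) {v : ι → F}
    (hv : ∀ i, v i ∈ K i) {s : F} (hs : HasSum v s) (i : ι) : (K i).starProjection s = v i := by
  have h1 := hs.mapL (K i).starProjection
  have h2 : HasSum (fun j => (K i).starProjection (v j)) ((K i).starProjection (v i)) := by
    refine hasSum_single i fun j hj => ?_
    refine (Submodule.starProjection_apply_eq_zero_iff _).2 ?_
    rw [Submodule.mem_orthogonal]
    intro w hw
    exact hK hj.symm ⟨w, hw⟩ ⟨v j, hv j⟩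
  rw [h1.unique h2]
  exact Submodule.starProjection_eq_self_iff.2 (hv i)

/-- Parseval's identity for a total orthogonal family of subspaces. -/
theorem hasSum_norm_starProjection_sq [CompleteSpace F]
    (hK : OrthogonalFamily ℂ (fun i => K i) fun i => (K i).subtypeₗᵢ) (htot : (⨆ i, K i)ᗮ = ⊥)
    (f : F) : HasSum (fun i => ‖(K i).starProjection f‖ ^ 2) (‖f‖ ^ 2) := by
  have hS : IsHilbertSum ℂ (fun i => K i) fun i => (K i).subtypeₗᵢ :=
    IsHilbertSum.mkInternal _ hK (Submodule.topologicalClosure_eq_top_iff.2 htot).ge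
  set w := hS.linearIsometryEquiv f with hw
  have h1 : HasSum (fun i => ((w i : K i) : F)) f := by
    have := hS.hasSum_linearIsometryEquiv_symm w
    rwa [hw, LinearIsometryEquiv.symm_apply_apply] at this
  have h2 := lp.hasSum_norm (by norm_num) w
  rw [hw, LinearIsometryEquiv.norm_map, ← hw] at h2
  simp only [ENNReal.toReal_ofNat, Real.rpow_ofNat] at h2
  convert h2 using 3 with i
  rw [starProjection_eq_of_hasSum hK (fun i => (w i).2) h1 i]
  rfl

theorem norm_tsum_sq [CompleteSpace F]
    (hK : OrthogonalFamily ℂ (fun i => K i) fun i => (K i).subtypeₗᵢ) (htot : (⨆ i, K i)ᗮ = ⊥)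
    {v : ι → F} (hv : ∀ i, v i ∈ K i) (hsum : Summable fun i => ‖v i‖ ^ 2) :
    ‖∑' i, v i‖ ^ 2 = ∑' i, ‖v i‖ ^ 2 := by
  have h1 : Summable v := (hK.summable_iff_norm_sq_summable fun i => ⟨v i, hv i⟩).2 hsum
  have h2 := hasSum_norm_starProjection_sq hK htot (∑' i, v i)
  simp_rw [starProjection_eq_of_hasSum hK hv h1.hasSum] at h2
  exact h2.tsum_eq.symm

/-- A quadratic inequality between the coefficients of three vectors along all the elements of a
subspace passes to their projections. -/
theorem norm_starProjection_sq_le {V : Submodule ℂ F} [V.HasOrthogonalProjection] {x y z : F}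
    {α β C : ℝ} (hβ : 0 ≤ β) (hC : 0 ≤ C)
    (h : ∀ f ∈ V, α * ‖inner ℂ f x‖ ^ 2 ≤ C * (β * ‖inner ℂ f y‖ ^ 2 + ‖inner ℂ f z‖ ^ 2)) :
    α * ‖V.starProjection x‖ ^ 2 ≤
      C * (β * ‖V.starProjection y‖ ^ 2 + ‖V.starProjection z‖ ^ 2) := by
  set f := V.starProjection x
  have hfV : f ∈ V := V.starProjection_apply_mem x
  have hinner : ∀ w, inner ℂ f w = inner ℂ f (V.starProjection w) := fun w => by
    conv_lhs => rw [← Submodule.starProjection_eq_self_iff.2 hfV]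
    exact V.inner_starProjection_left_eq_right f w
  have hle : ∀ w, ‖inner ℂ f w‖ ^ 2 ≤ ‖f‖ ^ 2 * ‖V.starProjection w‖ ^ 2 := fun w => by
    rw [hinner, ← mul_pow]
    gcongr
    exact norm_inner_le_norm _ _
  have hx : ‖inner ℂ f x‖ ^ 2 = ‖f‖ ^ 2 * ‖f‖ ^ 2 := by
    rw [hinner, inner_self_eq_norm_sq_to_K, norm_pow]
    simp only [RCLike.norm_ofReal, abs_norm]
    ring
  rcases eq_or_lt_of_le (sq_nonneg ‖f‖) with h0 | h0
  · rw [← h0, mul_zero]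
    positivity
  · have h1 := h f hfV
    rw [hx] at h1
    have h2 : C * (β * ‖inner ℂ f y‖ ^ 2 + ‖inner ℂ f z‖ ^ 2) ≤
        C * (β * (‖f‖ ^ 2 * ‖V.starProjection y‖ ^ 2) + ‖f‖ ^ 2 * ‖V.starProjection z‖ ^ 2) := by
      gcongr
      · exact hle y
      · exact hle z
    refine le_of_mul_le_mul_left ?_ h0
    linarith

end HilbertSum

/-! ### The spectral decomposition of the Laplace–Beltrami operator -/

theorem inner_eq_integral_conj {X : Type*} [MeasurableSpace X] {μ : Measure X} {f : Lp ℂ 2 μ}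
    {φ : X → ℂ} (hf : f =ᵐ[μ] φ) (g : Lp ℂ 2 μ) :
    inner ℂ f g = ∫ x, g x * (starRingEnd ℂ) (φ x) ∂μ := by
  rw [L2.inner_def]
  refine integral_congr_ae ?_
  filter_upwards [hf] with x hx
  rw [hx, RCLike.inner_apply]

section Spectral

variable {E : Type*} [NormedAddCommGroup E] [NormedSpace ℝ E] [FiniteDimensional ℝ E]
  {H : Type*} [TopologicalSpace H] {I : ModelWithCorners ℝ E H} [I.Boundaryless]
  {G : Type*} [TopologicalSpace G] [ChartedSpace H G] [Group G]
  [LieGroup I ∞ G] [MeasurableSpace G] (m : BiInvariantMetric I G)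
  (μ : Measure G)

/-- The classes of the smooth solutions of `-L φ = a φ`, before taking the closure. -/
noncomputable def smoothEigenspace (a : ℝ≥0) : Submodule ℂ (Lp ℂ 2 μ) where
  carrier := {f | ∃ φ : G → ℂ, ContMDiff I 𝓘(ℝ, ℂ) ∞ φ ∧
    (∀ x, -laplaceBeltrami m φ x = ((a : ℝ) : ℂ) * φ x) ∧ f =ᵐ[μ] φ}
  zero_mem' := by
    refine ⟨fun x => 0 * 0, contMDiff_const, fun x => ?_, ?_⟩
    · rw [laplaceBeltrami_const_mul m 0 contMDiff_const]
      simp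
    · filter_upwards [Lp.coeFn_zero ℂ 2 μ] with x hx
      exact hx.trans (by simp)
  add_mem' := by
    rintro f g ⟨φ, hφ, hφe, hfφ⟩ ⟨ψ, hψ, hψe, hgψ⟩
    refine ⟨fun x => φ x + ψ x, hφ.add hψ, fun x => ?_, ?_⟩
    · rw [laplaceBeltrami_add m hφ hψ, mul_add, ← hφe, ← hψe]
      ring
    · filter_upwards [Lp.coeFn_add f g, hfφ, hgψ] with x hx h1 h2
      rw [hx, Pi.add_apply, h1, h2]
  smul_mem' := by
    rintro c f ⟨φ, hφ, hφe, hfφ⟩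
    refine ⟨fun x => c * φ x, contMDiff_mul_complex contMDiff_const hφ, fun x => ?_, ?_⟩
    · rw [laplaceBeltrami_const_mul m c hφ, mul_left_comm, ← hφe]
      ring
    · filter_upwards [Lp.coeFn_smul c f, hfφ] with x hx h1
      rw [hx, Pi.smul_apply, h1, smul_eq_mul]

theorem eigenspace_eq_closure (a : ℝ≥0) :
    eigenspace m μ a = (smoothEigenspace m μ a).topologicalClosure :=
  congrArg Submodule.topologicalClosure (Submodule.span_eq (smoothEigenspace m μ a))

variable {μ} [CompactSpace G] [BorelSpace G]

theorem isOrtho_smoothEigenspace [SecondCountableTopology G] [IsFiniteMeasure μ]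
    [μ.IsMulRightInvariant] {a b : ℝ≥0} (hab : a ≠ b) :
    smoothEigenspace m μ a ⟂ smoothEigenspace m μ b := by
  rw [Submodule.isOrtho_iff_inner_eq]
  rintro f ⟨φ, hφ, hφe, hfφ⟩ g ⟨ψ, hψ, hψe, hgψ⟩
  have h1 : inner ℂ f g = ∫ x, (starRingEnd ℂ) (φ x) * ψ x ∂μ := by
    rw [inner_eq_integral_conj hfφ]
    refine integral_congr_ae ?_
    filter_upwards [hgψ] with x hx
    rw [hx, mul_comm]
  have h2 := integral_laplaceBeltrami_mul (μ := μ) m (contMDiff_conj hφ) hψ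
  rw [laplaceBeltrami_conj m hφ] at h2
  have hφ' : ∀ x, laplaceBeltrami m φ x = -((a : ℝ) : ℂ) * φ x := fun x => by
    rw [neg_mul, ← hφe, neg_neg]
  have hψ' : ∀ x, laplaceBeltrami m ψ x = -((b : ℝ) : ℂ) * ψ x := fun x => by
    rw [neg_mul, ← hψe, neg_neg]
  simp_rw [hφ', hψ', map_mul, map_neg, Complex.conj_ofReal, mul_assoc,
    mul_left_comm _ (-((b : ℝ) : ℂ)), integral_const_mul, ← h1] at h2
  have h3 : ((a : ℝ) : ℂ) ≠ ((b : ℝ) : ℂ) := by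
    simpa using hab
  have h4 : (((a : ℝ) : ℂ) - ((b : ℝ) : ℂ)) * inner ℂ f g = 0 := by linear_combination -h2
  exact (mul_eq_zero.1 h4).resolve_left (sub_ne_zero.2 h3)

theorem orthogonalFamily_eigenspace [SecondCountableTopology G] [IsFiniteMeasure μ]
    [μ.IsMulRightInvariant] :
    OrthogonalFamily ℂ (fun a => eigenspace m μ a) fun a => (eigenspace m μ a).subtypeₗᵢ := by
  refine OrthogonalFamily.of_pairwise fun a b hab => ?_
  change eigenspace m μ a ⟂ eigenspace m μ b
  rw [eigenspace_eq_closure, eigenspace_eq_closure, Submodule.isOrtho_iff_le,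
    Submodule.orthogonal_closure]
  exact Submodule.topologicalClosure_minimal _ (isOrtho_smoothEigenspace m hab)
    (Submodule.isClosed_orthogonal _)

variable [T2Space G] [SecondCountableTopology G] [IsTopologicalGroup G] [IsFiniteMeasure μ]
  [μ.IsMulRightInvariant] [μ.IsOpenPosMeasure]

theorem hasSum_norm_eigenComponent_sq (f : Lp ℂ 2 μ) :
    HasSum (fun a => ‖eigenComponent m μ a f‖ ^ 2) (‖f‖ ^ 2) :=
  hasSum_norm_starProjection_sq (orthogonalFamily_eigenspace m) (iSup_eigenspace_orthogonal m) f

theorem hasSum_norm_fracLaplacian_one_sq {f : Lp ℂ 2 μ} (hf : MemSobolev m μ 1 f) :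
    HasSum (fun a : ℝ≥0 => (a : ℝ) * ‖eigenComponent m μ a f‖ ^ 2)
      (‖fracLaplacian m μ 1 f‖ ^ 2) := by
  have h1 : ∀ a : ℝ≥0, ‖(((a : ℝ) ^ ((1 : ℝ) / 2) : ℝ) : ℂ) • eigenComponent m μ a f‖ ^ 2 =
      (a : ℝ) * ‖eigenComponent m μ a f‖ ^ 2 := fun a => by
    rw [norm_smul, mul_pow, Complex.norm_real, ← Real.sqrt_eq_rpow, Real.norm_of_nonneg
      (Real.sqrt_nonneg _), Real.sq_sqrt (NNReal.coe_nonneg a)]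
  have h2 : Summable fun a : ℝ≥0 => (a : ℝ) * ‖eigenComponent m μ a f‖ ^ 2 := by
    have := hf
    simpa only [MemSobolev, Real.rpow_one] using this
  have h3 := norm_tsum_sq (orthogonalFamily_eigenspace m) (iSup_eigenspace_orthogonal m)
    (v := fun a => (((a : ℝ) ^ ((1 : ℝ) / 2) : ℝ) : ℂ) • eigenComponent m μ a f)
    (fun a => Submodule.smul_mem _ _ (Submodule.starProjection_apply_mem _ _))
    (by simpa only [h1] using h2)
  simp_rw [h1] at h3
  rw [fracLaplacian, h3]
  exact h2.hasSum

end Spectral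

/-! ### Decay of the solutions -/

section Decay

variable {E : Type*} [NormedAddCommGroup E] [NormedSpace ℝ E] [FiniteDimensional ℝ E]
  {H : Type*} [TopologicalSpace H] {I : ModelWithCorners ℝ E H} [I.Boundaryless]
  {G : Type*} [TopologicalSpace G] [ChartedSpace H G] [Group G]
  [LieGroup I ∞ G] [MeasurableSpace G] {m : BiInvariantMetric I G}
  {μ : Measure G} {u₀ u₁ : Lp ℂ 2 μ} {u ut : ℝ → Lp ℂ 2 μ}

/-- The coefficient of a solution along a smooth eigenfunction solves the equation of a damped
oscillator. -/
theorem IsSolution.inner_decay (hu : IsSolution m μ u₀ u₁ u ut) {a : ℝ≥0} {f : Lp ℂ 2 μ}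
    (hf : f ∈ smoothEigenspace m μ a) {t : ℝ} (ht : 0 ≤ t) :
    ‖inner ℂ f (u t)‖ ^ 2 ≤ 409 * (‖inner ℂ f u₀‖ ^ 2 + ‖inner ℂ f u₁‖ ^ 2) ∧
    (1 + t) * (a * ‖inner ℂ f (u t)‖ ^ 2) ≤
      409 * ((1 + a) * ‖inner ℂ f u₀‖ ^ 2 + ‖inner ℂ f u₁‖ ^ 2) ∧
    (1 + t) ^ 2 * ‖inner ℂ f (ut t)‖ ^ 2 ≤
      409 * ((1 + a) * ‖inner ℂ f u₀‖ ^ 2 + ‖inner ℂ f u₁‖ ^ 2) := by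
  obtain ⟨φ, hφ, hφe, hfφ⟩ := hf
  let T : Lp ℂ 2 μ →L[ℝ] ℂ := (innerSL ℂ f).restrictScalars ℝ
  have hT : ∀ g, T g = inner ℂ f g := fun g => rfl
  have hcont : ContinuousOn u (Ici 0) := fun s hs => (hu.hasDerivWithinAt s hs).continuousWithinAt
  have h := dampedOscillator_decay (a := a) (c := fun s => T (u s)) (p := fun s => T (ut s)) a.2
    (T.continuous.comp_continuousOn hcont) (T.continuous.comp_continuousOn hu.continuousOn_deriv)
    (fun s hs => T.hasFDerivAt.comp_hasDerivAt s
      ((hu.hasDerivWithinAt s hs.le).hasDerivAt (Ici_mem_nhds hs)))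
    (fun s hs => by
      have h1 := hu.weak_equation _ (contMDiff_conj hφ) s hs
      have h2 : ∀ x, laplaceBeltrami m φ x = -((a : ℝ) : ℂ) * φ x := fun x => by
        rw [neg_mul, ← hφe, neg_neg]
      rw [laplaceBeltrami_conj m hφ] at h1
      simp_rw [h2, map_mul, map_neg, Complex.conj_ofReal, mul_left_comm _ (-((a : ℝ) : ℂ)),
        integral_const_mul, ← inner_eq_integral_conj hfφ] at h1
      refine h1.congr_deriv ?_
      rw [hT, hT, neg_mul]) ht
  simpa only [hT, hu.initial_value, hu.initial_deriv] using h

theorem IsSolution.eigenComponent_decay (hu : IsSolution m μ u₀ u₁ u ut) (a : ℝ≥0) {t : ℝ}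
    (ht : 0 ≤ t) :
    ‖eigenComponent m μ a (u t)‖ ^ 2 ≤
      409 * (‖eigenComponent m μ a u₀‖ ^ 2 + ‖eigenComponent m μ a u₁‖ ^ 2) ∧
    (1 + t) * (a * ‖eigenComponent m μ a (u t)‖ ^ 2) ≤
      409 * ((1 + a) * ‖eigenComponent m μ a u₀‖ ^ 2 + ‖eigenComponent m μ a u₁‖ ^ 2) ∧
    (1 + t) ^ 2 * ‖eigenComponent m μ a (ut t)‖ ^ 2 ≤
      409 * ((1 + a) * ‖eigenComponent m μ a u₀‖ ^ 2 + ‖eigenComponent m μ a u₁‖ ^ 2) := by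
  -- the inequalities pass from the smooth eigenfunctions to their closure
  let P : Lp ℂ 2 μ → Prop := fun f =>
    ‖inner ℂ f (u t)‖ ^ 2 ≤ 409 * (‖inner ℂ f u₀‖ ^ 2 + ‖inner ℂ f u₁‖ ^ 2) ∧
    (1 + t) * (a * ‖inner ℂ f (u t)‖ ^ 2) ≤
      409 * ((1 + a) * ‖inner ℂ f u₀‖ ^ 2 + ‖inner ℂ f u₁‖ ^ 2) ∧
    (1 + t) ^ 2 * ‖inner ℂ f (ut t)‖ ^ 2 ≤
      409 * ((1 + a) * ‖inner ℂ f u₀‖ ^ 2 + ‖inner ℂ f u₁‖ ^ 2)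
  have hP : IsClosed {f | P f} := by
    simp only [P, ofPred_and]
    refine (isClosed_le ?_ ?_).inter ((isClosed_le ?_ ?_).inter (isClosed_le ?_ ?_)) <;> fun_prop
  have key : ∀ f ∈ eigenspace m μ a, P f := by
    intro f hf
    rw [eigenspace_eq_closure] at hf
    exact closure_minimal (fun g hg => hu.inner_decay hg ht) hP hf
  have ha : (0 : ℝ) ≤ a := a.2
  have h1 := norm_starProjection_sq_le (V := eigenspace m μ a) (x := u t) (y := u₀) (z := u₁)
    (α := 1) (β := 1) (C := 409) zero_le_one (by norm_num) (fun f hf => by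
      simpa using (key f hf).1)
  have h2 := norm_starProjection_sq_le (V := eigenspace m μ a) (x := u t) (y := u₀) (z := u₁)
    (α := (1 + t) * a) (β := 1 + a) (C := 409) (by positivity) (by norm_num) (fun f hf => by
      rw [mul_assoc]
      exact (key f hf).2.1)
  have h3 := norm_starProjection_sq_le (V := eigenspace m μ a) (x := ut t) (y := u₀) (z := u₁)
    (α := (1 + t) ^ 2) (β := 1 + a) (C := 409) (by positivity) (by norm_num)
    (fun f hf => (key f hf).2.2)
  rw [one_mul, one_mul] at h1
  rw [mul_assoc] at h2
  exact ⟨h1, h2, h3⟩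

theorem IsSolution.norm_sq_decay [CompactSpace G] [BorelSpace G] [T2Space G]
    [SecondCountableTopology G] [IsTopologicalGroup G] [IsFiniteMeasure μ]
    [μ.IsMulRightInvariant] [μ.IsOpenPosMeasure]
    (hu : IsSolution m μ u₀ u₁ u ut) (hu₀ : MemSobolev m μ 1 u₀) {t : ℝ} (ht : 0 ≤ t) :
    ‖u t‖ ^ 2 ≤ 409 * (‖u₀‖ ^ 2 + ‖u₁‖ ^ 2) ∧
    (1 + t) * ‖fracLaplacian m μ 1 (u t)‖ ^ 2 ≤
      409 * (‖u₀‖ ^ 2 + ‖fracLaplacian m μ 1 u₀‖ ^ 2 + ‖u₁‖ ^ 2) ∧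
    (1 + t) ^ 2 * ‖ut t‖ ^ 2 ≤
      409 * (‖u₀‖ ^ 2 + ‖fracLaplacian m μ 1 u₀‖ ^ 2 + ‖u₁‖ ^ 2) := by
  have hdec := fun a => hu.eigenComponent_decay a ht
  have s0 := hasSum_norm_eigenComponent_sq m u₀
  have s1 := hasSum_norm_eigenComponent_sq m u₁
  have sf := hasSum_norm_fracLaplacian_one_sq m hu₀
  have sD : HasSum (fun a : ℝ≥0 => 409 * ((1 + (a : ℝ)) * ‖eigenComponent m μ a u₀‖ ^ 2 +
      ‖eigenComponent m μ a u₁‖ ^ 2))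
      (409 * (‖u₀‖ ^ 2 + ‖fracLaplacian m μ 1 u₀‖ ^ 2 + ‖u₁‖ ^ 2)) := by
    have := ((s0.add sf).add s1).mul_left 409
    simpa only [add_mul, one_mul] using this
  exact ⟨hasSum_le (fun a => (hdec a).1) (hasSum_norm_eigenComponent_sq m (u t))
      ((s0.add s1).mul_left 409),
    hasSum_le (fun a => (hdec a).2.1)
      ((hasSum_norm_fracLaplacian_one_sq m (hu.memSobolev t ht)).mul_left (1 + t)) sD,
    hasSum_le (fun a => (hdec a).2.2)
      ((hasSum_norm_eigenComponent_sq m (ut t)).mul_left ((1 + t) ^ 2)) sD⟩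

end Decay

/-- Compact groups are unimodular: a right translate of the normalized Haar measure is again a
normalized Haar measure. -/
theorem isMulRightInvariant_of_compactSpace {G : Type*} [TopologicalSpace G] [CompactSpace G]
    [Group G] [IsTopologicalGroup G] [MeasurableSpace G] [BorelSpace G] (μ : Measure G)
    [μ.IsHaarMeasure] [IsProbabilityMeasure μ] : μ.IsMulRightInvariant where
  map_mul_right_eq_self g := by
    have : IsProbabilityMeasure (μ.map (· * g)) :=
      Measure.isProbabilityMeasure_map (by fun_prop)
    exact Measure.isHaarMeasure_eq_of_isProbabilityMeasure _ _

end DampedWave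

theorem mainTheorem3
    {E : Type*} [NormedAddCommGroup E] [NormedSpace ℝ E] [FiniteDimensional ℝ E]
    {H : Type*} [TopologicalSpace H] (I : ModelWithCorners ℝ E H) [I.Boundaryless]
    (G : Type*) [TopologicalSpace G] [T2Space G] [CompactSpace G] [ChartedSpace H G]
    [Group G] [LieGroup I ∞ G] [MeasurableSpace G] [BorelSpace G]
    (m : DampedWave.BiInvariantMetric I G)
    (μ : Measure G) [μ.IsHaarMeasure] [IsProbabilityMeasure μ] :
    ∃ C : ℝ, 0 < C ∧
      ∀ (u₀ u₁ : Lp ℂ 2 μ) (u ut : ℝ → Lp ℂ 2 μ),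
        DampedWave.MemSobolev m μ 1 u₀ →
        DampedWave.IsSolution m μ u₀ u₁ u ut →
        ∀ t : ℝ, 0 ≤ t →
          ‖u t‖ ≤ C * (‖u₀‖ + ‖u₁‖) ∧
          ‖DampedWave.fracLaplacian m μ 1 (u t)‖ ≤
            C * (1 + t) ^ (-(1 / 2) : ℝ) * (DampedWave.sobolevNorm m μ 1 u₀ + ‖u₁‖) ∧
          ‖ut t‖ ≤ C * (1 + t)⁻¹ * (DampedWave.sobolevNorm m μ 1 u₀ + ‖u₁‖) := by
  have : IsTopologicalGroup G := topologicalGroup_of_lieGroup I ∞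
  have : SecondCountableTopology H := I.secondCountableTopology
  have : SecondCountableTopology G := ChartedSpace.secondCountable_of_sigmaCompact H G
  have : μ.IsMulRightInvariant := DampedWave.isMulRightInvariant_of_compactSpace μ
  -- `21 ^ 2 = 441` exceeds the constant of the squared estimates
  refine ⟨21, by norm_num, fun u₀ u₁ u ut hu₀ hu t ht => ?_⟩
  obtain ⟨h1, h2, h3⟩ := hu.norm_sq_decay hu₀ ht
  have n0 := norm_nonneg u₀
  have n1 := norm_nonneg u₁
  have nf := norm_nonneg (DampedWave.fracLaplacian m μ 1 u₀)
  rw [DampedWave.sobolevNorm]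
  have hD : 409 * (‖u₀‖ ^ 2 + ‖DampedWave.fracLaplacian m μ 1 u₀‖ ^ 2 + ‖u₁‖ ^ 2) ≤
      (21 * (‖u₀‖ + ‖DampedWave.fracLaplacian m μ 1 u₀‖ + ‖u₁‖)) ^ 2 := by
    nlinarith [mul_nonneg n0 n1, mul_nonneg n0 nf, mul_nonneg nf n1, sq_nonneg ‖u₀‖,
      sq_nonneg ‖u₁‖, sq_nonneg ‖DampedWave.fracLaplacian m μ 1 u₀‖]
  have ht1 : 0 < 1 + t := by linarith
  refine ⟨?_, ?_, ?_⟩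
  · refine le_of_sq_le_sq (h1.trans ?_) (by positivity)
    nlinarith [mul_nonneg n0 n1, sq_nonneg ‖u₀‖, sq_nonneg ‖u₁‖]
  · have hs : 0 < √(1 + t) := Real.sqrt_pos.2 ht1
    have h4 : √(1 + t) * ‖DampedWave.fracLaplacian m μ 1 (u t)‖ ≤
        21 * (‖u₀‖ + ‖DampedWave.fracLaplacian m μ 1 u₀‖ + ‖u₁‖) := by
      refine le_of_sq_le_sq ?_ (by positivity)
      rw [mul_pow, Real.sq_sqrt ht1.le]
      exact h2.trans hD
    rw [Real.rpow_neg ht1.le, ← Real.sqrt_eq_rpow, mul_right_comm, ← div_eq_mul_inv,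
      le_div_iff₀ hs, mul_comm]
    exact h4
  · have h4 : (1 + t) * ‖ut t‖ ≤
        21 * (‖u₀‖ + ‖DampedWave.fracLaplacian m μ 1 u₀‖ + ‖u₁‖) := by
      refine le_of_sq_le_sq ?_ (by positivity)
      rw [mul_pow]
      exact h3.trans hD
    rw [mul_right_comm, ← div_eq_mul_inv, le_div_iff₀ ht1, mul_comm]
    exact h4
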